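/- Let $A\in\mathbb C^{n\times n}$ be stable (all eigenvalues in the open unit disc), let $B\in\mathbb C^{n\times m}$ have full rank with $(A,B)$ reachable, and put $G(z)=(zI-A)^{-1}B$. Integrals without indication are over the unit circle $\mathbb T$ with respect to normalized Lebesgue measure $d\vartheta/2\pi$, and $M^*$ denotes the conjugate transpose (so $G^*(z)=G(z)^*$ for $z\in\mathbb T$). Assume that the constraint $\int G\Phi G^*=I$ is feasible, i.e. there is $H\in\mathbb C^{m\times n}$ with $I-AA^*=BH+H^*B^*$. Let $\Psi$ be a measurable function on $\mathbb T$ whose values are Hermitian positive definite $m\times m$ matrices and which is bounded and coercive ($\Psi\ge cI$ on $\mathbb T$ for some $c>0$). Let $\mathcal H(k)$ be the real vector space of Hermitian $k\times k$ matrices, $\Gamma: C(\mathbb T;\mathcal H(m))\to\mathcal H(n)$, $\Gamma(\Phi)=\int G\Phi G^*$, and regard $\operatorname{Range}\Gamma$ as a real vector space with scalar product $\langle X,Y\rangle=\operatorname{tr}XY^*$. Let $$\mathcal L^H_\Gamma=\{\Lambda\in\operatorname{Range}\Gamma:\ I+G^*\Lambda G>0\ \text{ on } \mathbb T\},\qquad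 J_\Psi(\Lambda)=\operatorname{tr}\int (I+G^*\Lambda G)^{-1}\Psi+\operatorname{tr}\Lambda\quad(\Lambda\in\mathcal L^H_\Gamma),$$ and let $S=\{\Lambda\in\mathcal L^H_\Gamma: J_\Psi(\Lambda)\le \operatorname{tr}\int\Psi\}$. Write $\nabla J_\Lambda(\cdot)$ and $H_\Lambda(\cdot,\cdot)$ for the first and second derivatives of $J_\Psi$ at $\Lambda$, as a linear and a bilinear form on $\operatorname{Range}\Gamma$. For $0<\alpha<1/2$, the Newton algorithm with backtracking generates a sequence as follows. Put $\Lambda_0=0$. Given $\Lambda_i$, if $\nabla J_{\Lambda_i}=0$ the algorithm stops, i.e. $\Lambda_{i+1}=\Lambda_i$. Otherwise let $\Delta\Lambda_i\in\operatorname{Range}\Gamma$ solve $H_{\Lambda_i}(\Delta\Lambda_i,\cdot)=-\nabla J_{\Lambda_i}(\cdot)$, let $t_i$ be the first of the numbers $1,\tfrac12,\tfrac14,\dots$ such that $$\Lambda_i+t_i\Delta\Lambda_i\in\mathcal L^H_\Gamma\quad\text{and}\quad J_\Psi(\Lambda_i+t_i\Delta\Lambda_i)<J_\Psi(\Lambda_i)+\alpha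 t_i\nabla J_{\Lambda_i}(\Delta\Lambda_i),$$ and put $\Lambda_{i+1}=\Lambda_i+t_i\Delta\Lambda_i$. Then $S$ is compact, and: 1. $J_\Psi$ is twice continuously differentiable at (in a neighbourhood in $\operatorname{Range}\Gamma$ of) every point of $S$; 2. $J_\Psi$ is strongly convex on $S$: there is $c>0$ with $H_\Lambda(\delta,\delta)\ge c\|\delta\|^2$ for all $\Lambda\in S$ and $\delta\in\operatorname{Range}\Gamma$; 3. the Hessian $\Lambda\mapsto H_\Lambda$ is Lipschitz continuous on $S$; 4. $J_\Psi$ has a unique minimum point on $\mathcal L^H_\Gamma$, and for every $\alpha\in(0,1/2)$ the Newton algorithm is well defined (it generates exactly one infinite sequence $\{\Lambda_i\}$) and $\Lambda_i$ converges to this minimum point. -/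

import Mathlib

open scoped Matrix ComplexOrder

namespace HellingerNewton

noncomputable section

/-- Entrywise integral over the unit circle of a matrix-valued function, with respect to the
normalized Lebesgue measure `dϑ / 2π`. -/
def normCircleIntegral {ι κ : Type*} (F : Circle → Matrix ι κ ℂ) : Matrix ι κ ℂ :=
  Matrix.of fun i j =>
    (2 * Real.pi)⁻¹ • ∫ θ in (0 : ℝ)..(2 * Real.pi), F (Circle.exp θ) i j

/-- The real vector space of Hermitian `k × k` complex matrices. -/
abbrev Herm (k : ℕ) : Submodule ℝ (Matrix (Fin k) (Fin k) ℂ) :=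
  selfAdjoint.submodule ℝ (Matrix (Fin k) (Fin k) ℂ)

/-- Discrete-time stability: all the eigenvalues lie in the open unit disc. -/
def IsStable {n : ℕ} (A : Matrix (Fin n) (Fin n) ℂ) : Prop :=
  ∀ μ ∈ spectrum ℂ A, ‖μ‖ < 1

/-- `(A, B)` is reachable: the matrix `[B, AB, …, A^(n-1) B]` has rank `n`. -/
def IsReachable {n m : ℕ} (A : Matrix (Fin n) (Fin n) ℂ) (B : Matrix (Fin n) (Fin m) ℂ) : Prop :=
  (Matrix.of fun (i : Fin n) (p : Fin n × Fin m) => (A ^ (p.1 : ℕ) * B) i p.2).rank = n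

/-- The constraint `∫ G Φ G* = I` is feasible: `I - A A* = B H + H* B*` for some `H`. -/
def IsFeasible {n m : ℕ} (A : Matrix (Fin n) (Fin n) ℂ) (B : Matrix (Fin n) (Fin m) ℂ) : Prop :=
  ∃ H : Matrix (Fin m) (Fin n) ℂ, 1 - A * Aᴴ = B * H + Hᴴ * Bᴴ

/-- The spectral densities: (measurable) functions on the unit circle whose values are Hermitian
positive definite matrices, bounded and coercive. -/
structure IsSpectralDensity {m : ℕ} (Ψ : Circle → Matrix (Fin m) (Fin m) ℂ) : Prop where
  measurable : ∀ i j, Measurable fun θ : ℝ => Ψ (Circle.exp θ) i j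
  posDef : ∀ z, (Ψ z).PosDef
  bounded : ∃ M : ℝ, ∀ z i j, ‖Ψ z i j‖ ≤ M
  coercive : ∃ c : ℝ, 0 < c ∧ ∀ z, (Ψ z - (c : ℂ) • (1 : Matrix (Fin m) (Fin m) ℂ)).PosSemidef

/-- The transfer function `G(z) = (zI - A)⁻¹ B` on the unit circle. -/
def transfer {n m : ℕ} (A : Matrix (Fin n) (Fin n) ℂ) (B : Matrix (Fin n) (Fin m) ℂ)
    (z : Circle) : Matrix (Fin n) (Fin m) ℂ :=
  ((z : ℂ) • (1 : Matrix (Fin n) (Fin n) ℂ) - A)⁻¹ * B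

theorem det_ne_zero_of_isStable {n : ℕ} {A : Matrix (Fin n) (Fin n) ℂ} (hA : IsStable A)
    (z : Circle) : ((z : ℂ) • (1 : Matrix (Fin n) (Fin n) ℂ) - A).det ≠ 0 := by
  intro h
  have hz : (z : ℂ) ∈ spectrum ℂ A := by
    rw [spectrum.mem_iff, Algebra.algebraMap_eq_smul_one, Matrix.isUnit_iff_isUnit_det, h]
    simp
  exact absurd (hA _ hz) (by simp [Circle.norm_coe])

theorem continuous_transfer {n m : ℕ} {A : Matrix (Fin n) (Fin n) ℂ} (hA : IsStable A)
    (B : Matrix (Fin n) (Fin m) ℂ) : Continuous (transfer A B) := by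
  have hM : Continuous fun z : Circle => (z : ℂ) • (1 : Matrix (Fin n) (Fin n) ℂ) - A :=
    (continuous_subtype_val.smul continuous_const).sub continuous_const
  unfold transfer
  refine Continuous.matrix_mul ?_ continuous_const
  simp only [Matrix.inv_def, Ring.inverse_eq_inv']
  exact (hM.matrix_det.inv₀ (det_ne_zero_of_isStable hA)).smul hM.matrix_adjugate

theorem continuous_sandwich {n m : ℕ} {A : Matrix (Fin n) (Fin n) ℂ} (hA : IsStable A)
    (B : Matrix (Fin n) (Fin m) ℂ) (Φ : C(Circle, Herm m))
    (i j : Fin n) :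
    Continuous fun θ : ℝ => (transfer A B (Circle.exp θ) *
      (Φ (Circle.exp θ) : Matrix (Fin m) (Fin m) ℂ) * (transfer A B (Circle.exp θ))ᴴ) i j := by
  have h1 : Continuous fun θ : ℝ => transfer A B (Circle.exp θ) :=
    (continuous_transfer hA B).comp Circle.exp.continuous
  have h2 : Continuous fun θ : ℝ => (Φ (Circle.exp θ) : Matrix (Fin m) (Fin m) ℂ) :=
    continuous_subtype_val.comp (Φ.continuous.comp Circle.exp.continuous)
  exact ((h1.matrix_mul h2).matrix_mul h1.matrix_conjTranspose).matrix_elem i j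

/-- The real-linear operator `Γ : C(𝕋; H(m)) → H(n)`, `Γ(Φ) = ∫ G Φ G*`, where `H(m)` is the real
vector space of Hermitian matrices. The codomain is written as the space of all complex matrices;
`isHermitian_Gamma` shows that the values are Hermitian. -/
def Gamma {n m : ℕ} (A : Matrix (Fin n) (Fin n) ℂ) (B : Matrix (Fin n) (Fin m) ℂ)
    (hA : IsStable A) :
    C(Circle, Herm m) →ₗ[ℝ] Matrix (Fin n) (Fin n) ℂ where
  toFun Φ := normCircleIntegral fun z =>
    transfer A B z * (Φ z : Matrix (Fin m) (Fin m) ℂ) * (transfer A B z)ᴴ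
  map_add' Φ₁ Φ₂ := by
    ext i j
    have h1 := (continuous_sandwich hA B Φ₁ i j).intervalIntegrable (μ := MeasureTheory.volume)
      0 (2 * Real.pi)
    have h2 := (continuous_sandwich hA B Φ₂ i j).intervalIntegrable (μ := MeasureTheory.volume)
      0 (2 * Real.pi)
    simp only [normCircleIntegral, Matrix.of_apply, Matrix.add_apply, ← smul_add,
      ← intervalIntegral.integral_add h1 h2]
    simp [Matrix.mul_add, Matrix.add_mul]
  map_smul' c Φ := by
    ext i j
    simp only [normCircleIntegral, Matrix.of_apply, Matrix.smul_apply, RingHom.id_apply]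
    rw [smul_comm c, ← intervalIntegral.integral_smul]
    simp

theorem isHermitian_Gamma {n m : ℕ} (A : Matrix (Fin n) (Fin n) ℂ)
    (B : Matrix (Fin n) (Fin m) ℂ) (hA : IsStable A)
    (Φ : C(Circle, Herm m)) : (Gamma A B hA Φ).IsHermitian := by
  ext i j
  have key : ∀ θ : ℝ, star ((transfer A B (Circle.exp θ) *
      (Φ (Circle.exp θ) : Matrix (Fin m) (Fin m) ℂ) * (transfer A B (Circle.exp θ))ᴴ) j i) =
      (transfer A B (Circle.exp θ) *
      (Φ (Circle.exp θ) : Matrix (Fin m) (Fin m) ℂ) * (transfer A B (Circle.exp θ))ᴴ) i j := by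
    intro θ
    have hΦ : (Φ (Circle.exp θ) : Matrix (Fin m) (Fin m) ℂ)ᴴ = Φ (Circle.exp θ) :=
      (Φ (Circle.exp θ)).2
    rw [← Matrix.conjTranspose_apply, Matrix.conjTranspose_mul, Matrix.conjTranspose_mul, hΦ,
      Matrix.conjTranspose_conjTranspose, Matrix.mul_assoc]
  rw [Matrix.conjTranspose_apply]
  simp only [Gamma, normCircleIntegral, LinearMap.coe_mk, AddHom.coe_mk, Matrix.of_apply]
  rw [← funext key]
  simp only [Complex.real_smul, star_mul', Complex.star_def, Complex.conj_ofReal,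
    intervalIntegral.intervalIntegral_eq_integral_uIoc, ← integral_conj]

/-- The real vector space `Range Γ`, made below into a normed space. -/
def RangeGamma {n m : ℕ} (A : Matrix (Fin n) (Fin n) ℂ) (B : Matrix (Fin n) (Fin m) ℂ)
    (hA : IsStable A) : Type :=
  LinearMap.range (Gamma A B hA)

/-- An element of `Range Γ` as a matrix. -/
def RangeGamma.toMatrix {n m : ℕ} {A : Matrix (Fin n) (Fin n) ℂ} {B : Matrix (Fin n) (Fin m) ℂ}
    {hA : IsStable A} (Λ : RangeGamma A B hA) : Matrix (Fin n) (Fin n) ℂ :=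
  Subtype.val Λ

/-- `Range Γ` carries the Frobenius norm, that is, the norm of the scalar product
`⟨X, Y⟩ = tr X Y*`. -/
instance RangeGamma.normedAddCommGroup {n m : ℕ} (A : Matrix (Fin n) (Fin n) ℂ) (B : Matrix (Fin n) (Fin m) ℂ)
    (hA : IsStable A) : NormedAddCommGroup (RangeGamma A B hA) :=
  letI : NormedAddCommGroup (Matrix (Fin n) (Fin n) ℂ) := Matrix.frobeniusNormedAddCommGroup
  inferInstanceAs (NormedAddCommGroup (LinearMap.range (Gamma A B hA)))

instance RangeGamma.normedSpace {n m : ℕ} (A : Matrix (Fin n) (Fin n) ℂ) (B : Matrix (Fin n) (Fin m) ℂ)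
    (hA : IsStable A) : NormedSpace ℝ (RangeGamma A B hA) :=
  letI : NormedAddCommGroup (Matrix (Fin n) (Fin n) ℂ) := Matrix.frobeniusNormedAddCommGroup
  letI : NormedSpace ℝ (Matrix (Fin n) (Fin n) ℂ) := Matrix.frobeniusNormedSpace
  inferInstanceAs (NormedSpace ℝ (LinearMap.range (Gamma A B hA)))

/-- `Q_Λ(z) = I + G*(z) Λ G(z)` on the unit circle. -/
def Q {n m : ℕ} (A : Matrix (Fin n) (Fin n) ℂ) (B : Matrix (Fin n) (Fin m) ℂ)
    (Λ : Matrix (Fin n) (Fin n) ℂ) (z : Circle) : Matrix (Fin m) (Fin m) ℂ :=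
  1 + (transfer A B z)ᴴ * Λ * transfer A B z

/-- The Hermitian matrices `Λ` with `I + G* Λ G > 0` on the whole unit circle. -/
def LH {n m : ℕ} (A : Matrix (Fin n) (Fin n) ℂ) (B : Matrix (Fin n) (Fin m) ℂ) :
    Set (Matrix (Fin n) (Fin n) ℂ) :=
  {Λ | Λ.IsHermitian ∧ ∀ z : Circle, (Q A B Λ z).PosDef}

/-- `Range Γ ∩ LH`, as a subset of the real vector space `Range Γ`. -/
def LHGamma {n m : ℕ} (A : Matrix (Fin n) (Fin n) ℂ) (B : Matrix (Fin n) (Fin m) ℂ)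
    (hA : IsStable A) : Set (RangeGamma A B hA) :=
  {Λ | Λ.toMatrix ∈ LH A B}

/-- The functional `J_Ψ(Λ) = tr ∫ (I + G* Λ G)⁻¹ Ψ + tr Λ` (a real number on `LHGamma`). -/
def J {n m : ℕ} (A : Matrix (Fin n) (Fin n) ℂ) (B : Matrix (Fin n) (Fin m) ℂ)
    (hA : IsStable A) (Ψ : Circle → Matrix (Fin m) (Fin m) ℂ) (Λ : RangeGamma A B hA) : ℝ :=
  ((normCircleIntegral fun z => (Q A B Λ.toMatrix z)⁻¹ * Ψ z).trace
    + Λ.toMatrix.trace).re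

/-- The sublevel set `{Λ ∈ LHGamma : J_Ψ(Λ) ≤ tr ∫ Ψ}`. -/
def sublevel {n m : ℕ} (A : Matrix (Fin n) (Fin n) ℂ) (B : Matrix (Fin n) (Fin m) ℂ)
    (hA : IsStable A) (Ψ : Circle → Matrix (Fin m) (Fin m) ℂ) : Set (RangeGamma A B hA) :=
  {Λ | Λ ∈ LHGamma A B hA ∧ J A B hA Ψ Λ ≤ (normCircleIntegral Ψ).trace.re}

/-- The gradient of `J_Ψ` at `Λ`, a linear form on `Range Γ`. -/
def grad {n m : ℕ} (A : Matrix (Fin n) (Fin n) ℂ) (B : Matrix (Fin n) (Fin m) ℂ)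
    (hA : IsStable A) (Ψ : Circle → Matrix (Fin m) (Fin m) ℂ) (Λ : RangeGamma A B hA) :
    RangeGamma A B hA →L[ℝ] ℝ :=
  fderiv ℝ (J A B hA Ψ) Λ

/-- The Hessian of `J_Ψ` at `Λ`, a bilinear form on `Range Γ`. -/
def hess {n m : ℕ} (A : Matrix (Fin n) (Fin n) ℂ) (B : Matrix (Fin n) (Fin m) ℂ)
    (hA : IsStable A) (Ψ : Circle → Matrix (Fin m) (Fin m) ℂ) (Λ : RangeGamma A B hA) :
    RangeGamma A B hA →L[ℝ] RangeGamma A B hA →L[ℝ] ℝ :=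
  fderiv ℝ (grad A B hA Ψ) Λ

/-- The acceptance test of the line search, for the multiplier `t`. -/
def Accepts {n m : ℕ} (A : Matrix (Fin n) (Fin n) ℂ) (B : Matrix (Fin n) (Fin m) ℂ)
    (hA : IsStable A) (Ψ : Circle → Matrix (Fin m) (Fin m) ℂ) (α : ℝ)
    (Λ Δ : RangeGamma A B hA) (t : ℝ) : Prop :=
  Λ + t • Δ ∈ LHGamma A B hA ∧
    J A B hA Ψ (Λ + t • Δ) < J A B hA Ψ Λ + α * t * grad A B hA Ψ Λ Δ

/-- One Newton iteration with backtracking from `Λ` to `Λ'`: the direction `Δ` solves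
`Hess_Λ(Δ, ·) = -∇J_Λ(·)`, and the multiplier `1, 1/2, 1/4, …` is halved until it is accepted. -/
def IsNewtonIteration {n m : ℕ} (A : Matrix (Fin n) (Fin n) ℂ) (B : Matrix (Fin n) (Fin m) ℂ)
    (hA : IsStable A) (Ψ : Circle → Matrix (Fin m) (Fin m) ℂ) (α : ℝ)
    (Λ Λ' : RangeGamma A B hA) : Prop :=
  ∃ (Δ : RangeGamma A B hA) (k : ℕ),
    (∀ δ, hess A B hA Ψ Λ Δ δ = -grad A B hA Ψ Λ δ) ∧
    Accepts A B hA Ψ α Λ Δ ((1 / 2 : ℝ) ^ k) ∧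
    (∀ j < k, ¬ Accepts A B hA Ψ α Λ Δ ((1 / 2 : ℝ) ^ j)) ∧
    Λ' = Λ + ((1 / 2 : ℝ) ^ k) • Δ

/-- The sequence generated by the Newton algorithm with backtracking parameter `α`, started at `0`.
The iteration stops (the sequence stays constant) as soon as the gradient vanishes; there the
strict inequality of the acceptance test cannot hold. -/
def IsNewtonSequence {n m : ℕ} (A : Matrix (Fin n) (Fin n) ℂ) (B : Matrix (Fin n) (Fin m) ℂ)
    (hA : IsStable A) (Ψ : Circle → Matrix (Fin m) (Fin m) ℂ) (α : ℝ)
    (Λ : ℕ → RangeGamma A B hA) : Prop :=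
  Λ 0 = 0 ∧ ∀ i,
    (grad A B hA Ψ (Λ i) = 0 → Λ (i + 1) = Λ i) ∧
    (grad A B hA Ψ (Λ i) ≠ 0 → IsNewtonIteration A B hA Ψ α (Λ i) (Λ (i + 1)))

end

end HellingerNewton

open HellingerNewton
open scoped Topology

open HellingerNewton
open scoped Topology

/-! On the open convex set `LHGamma` the functional has the form `L((1 + TΛ)⁻¹) + τ(Λ)`, where `T :
Λ ↦ G*ΛG` takes values in the Banach algebra of continuous matrix functions on the circle, `L(F) =
Re tr ∫ FΨ` and `τ` is the trace. Inversion in a Banach algebra is smooth, so no differentiation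
under the integral is needed. With `Q = 1 + TΛ` and `d = Tδ`, the second derivative is `2 Re tr ∫
Q⁻¹dQ⁻¹dQ⁻¹Ψ`; it is positive for `δ ≠ 0` because `Ψ` is coercive and `T` is injective on `Range Γ`
(`sandwichMap_injective`, `hess_J_pos`).

The heart is compactness of the sublevel set (`isCompact_sublevel`). Feasibility yields a continuous
`Φ₀ > 0` with `tr Λ = Re tr ∫ Φ₀G*ΛG` (`exists_posDef_re_trace_eq`), so `J` controls the means of
both `tr Q` and `tr Q⁻¹` (`exists_le_J`). The mean of `tr Q` bounds `‖Λ‖`, hence the Lipschitz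
constant of `Q` along the circle. If a Lipschitz `Q` came close to a singular matrix somewhere, `∫
tr Q⁻¹` would be logarithmically large, so `Q` is bounded below uniformly on the sublevel set
(`le_quadForm_of_circleMean_le`). The set therefore stays away from the boundary of the domain.

The remaining claims hold for any `C³` function with positive definite Hessian on an open convex set
and a compact sublevel set. Strong convexity and the Lipschitz bound are compactness arguments.
Newton's method converges because near a noncritical point each step lowers the function by a fixed
amount (`eventually_newtonStep_decrease`), so every cluster point is critical, and the only critical
point is the minimum. -/

namespace HellingerNewton

/-! ### Convexity and Hessian bounds for functions with positive definite Hessian. -/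

section StrictlyConvex

variable {E : Type*} [NormedAddCommGroup E] [NormedSpace ℝ E] {f : E → ℝ} {U : Set E}

/-- The tangent plane inequality for a function with positive definite Hessian. -/
theorem add_fderiv_sub_lt_of_hessian_pos (hconv : Convex ℝ U)
    (hf : ∀ x ∈ U, ContDiffAt ℝ 3 f x)
    (hpos : ∀ x ∈ U, ∀ δ : E, δ ≠ 0 → 0 < fderiv ℝ (fderiv ℝ f) x δ δ)
    {x y : E} (hx : x ∈ U) (hy : y ∈ U) (hxy : y ≠ x) :
    f x + fderiv ℝ f x (y - x) < f y := by
  set d := y - x with hd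
  have hd0 : d ≠ 0 := sub_ne_zero.2 hxy
  have hmem : ∀ t : ℝ, t ∈ Set.Icc (0 : ℝ) 1 → x + t • d ∈ U := by
    intro t ht
    have := hconv.add_smul_sub_mem hx hy ht
    simpa [hd] using this
  have hline : ∀ t : ℝ, HasDerivAt (fun s : ℝ => x + s • d) d t := by
    intro t
    simpa using ((hasDerivAt_id t).smul_const d).const_add x
  have h1 : ∀ t ∈ Set.Icc (0 : ℝ) 1,
      HasDerivAt (fun s : ℝ => f (x + s • d)) (fderiv ℝ f (x + t • d) d) t := by
    intro t ht
    exact ((hf _ (hmem t ht)).differentiableAt (by norm_num)).hasFDerivAt.comp_hasDerivAt t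
      (hline t)
  have h2 : ∀ t ∈ Set.Icc (0 : ℝ) 1,
      HasDerivAt (fun s : ℝ => fderiv ℝ f (x + s • d) d)
        (fderiv ℝ (fderiv ℝ f) (x + t • d) d d) t := by
    intro t ht
    have hd1 : DifferentiableAt ℝ (fderiv ℝ f) (x + t • d) :=
      ((hf _ (hmem t ht)).fderiv_right (m := 1) (by norm_num)).differentiableAt (by norm_num)
    have := hd1.hasFDerivAt.comp_hasDerivAt t (hline t)
    simpa using this.clm_apply (hasDerivAt_const t d)
  -- Two mean values on the segment: the increment of `f` is its slope at some `ξ`, and the slope at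
  -- `ξ` exceeds the slope at `0` by a positive multiple of a Hessian value.
  obtain ⟨ξ, hξ, hξe⟩ := exists_hasDerivAt_eq_slope (fun s : ℝ => f (x + s • d))
    (fun t => fderiv ℝ f (x + t • d) d) zero_lt_one
    (fun t ht => (h1 t ht).continuousAt.continuousWithinAt)
    (fun t ht => h1 t (Set.Ioo_subset_Icc_self ht))
  have hsub : ∀ t, t ∈ Set.Icc (0 : ℝ) ξ → t ∈ Set.Icc (0 : ℝ) 1 :=
    fun t ht => ⟨ht.1, ht.2.trans hξ.2.le⟩
  obtain ⟨η, hη, hηe⟩ := exists_hasDerivAt_eq_slope (fun s : ℝ => fderiv ℝ f (x + s • d) d)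
    (fun t => fderiv ℝ (fderiv ℝ f) (x + t • d) d d) hξ.1
    (fun t ht => (h2 t (hsub t ht)).continuousAt.continuousWithinAt)
    (fun t ht => h2 t (hsub t (Set.Ioo_subset_Icc_self ht)))
  have hp := hpos _ (hmem η (hsub η (Set.Ioo_subset_Icc_self hη))) d hd0
  rw [hηe] at hp
  have hp' := (div_pos_iff_of_pos_right (by linarith [hξ.1])).1 hp
  simp only [zero_smul, add_zero, one_smul, sub_zero, div_one] at hp' hξe
  have : x + d = y := by simp [hd]
  rw [this] at hξe
  linarith

/-- Average the tangent plane inequalities at the convex combination `z = a x + b y`: the linear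
terms cancel and leave `f z ≤ a f x + b f y`. -/
theorem convex_sublevel_of_hessian_pos (hconv : Convex ℝ U)
    (hf : ∀ x ∈ U, ContDiffAt ℝ 3 f x)
    (hpos : ∀ x ∈ U, ∀ δ : E, δ ≠ 0 → 0 < fderiv ℝ (fderiv ℝ f) x δ δ) (r : ℝ) :
    Convex ℝ {x | x ∈ U ∧ f x ≤ r} := by
  have key : ∀ z ∈ U, ∀ x ∈ U, f z + fderiv ℝ f z (x - z) ≤ f x := by
    intro z hz x hx
    rcases eq_or_ne x z with rfl | h
    · simp
    · exact (add_fderiv_sub_lt_of_hessian_pos hconv hf hpos hz hx h).le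
  rintro x ⟨hx, hxr⟩ y ⟨hy, hyr⟩ a b ha hb hab
  have hz := hconv hx hy ha hb hab
  refine ⟨hz, ?_⟩
  have h1 := key _ hz x hx
  have h2 := key _ hz y hy
  set z := a • x + b • y with hzdef
  have h3 : a * fderiv ℝ f z (x - z) + b * fderiv ℝ f z (y - z) = 0 := by
    rw [← smul_eq_mul, ← smul_eq_mul, ← map_smul, ← map_smul, ← map_add]
    have : a • (x - z) + b • (y - z) = 0 := by
      rw [smul_sub, smul_sub, sub_add_sub_comm, ← add_smul, hab, one_smul, hzdef, sub_self]
    rw [this, map_zero]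
  have h4 := mul_le_mul_of_nonneg_left (h1.trans hxr) ha
  have h5 := mul_le_mul_of_nonneg_left (h2.trans hyr) hb
  have h6 : f z = a * f z + b * f z := by rw [← add_mul, hab, one_mul]
  have h7 : r = a * r + b * r := by rw [← add_mul, hab, one_mul]
  linarith

/-- The constant is the minimum of the Hessian form on `S` times the unit sphere; homogeneity
extends the bound to all directions. -/
theorem exists_pos_le_hessian [FiniteDimensional ℝ E] {S : Set E} (hS : IsCompact S)
    (hf : ∀ x ∈ S, ContDiffAt ℝ 3 f x)
    (hpos : ∀ x ∈ S, ∀ δ : E, δ ≠ 0 → 0 < fderiv ℝ (fderiv ℝ f) x δ δ) :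
    ∃ c : ℝ, 0 < c ∧ ∀ x ∈ S, ∀ δ : E, c * ‖δ‖ ^ 2 ≤ fderiv ℝ (fderiv ℝ f) x δ δ := by
  have hK : IsCompact (S ×ˢ Metric.sphere (0 : E) 1) :=
    hS.prod (isCompact_sphere 0 1)
  have hcont : ContinuousOn (fun p : E × E => fderiv ℝ (fderiv ℝ f) p.1 p.2 p.2)
      (S ×ˢ Metric.sphere (0 : E) 1) := by
    have h1 : ContinuousOn (fun p : E × E => fderiv ℝ (fderiv ℝ f) p.1)
        (S ×ˢ Metric.sphere (0 : E) 1) := by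
      intro p hp
      have hc : ContinuousAt (fderiv ℝ (fderiv ℝ f)) p.1 :=
        (((hf _ hp.1).fderiv_right (m := 2) (by norm_num)).fderiv_right (m := 1)
          (by norm_num)).continuousAt
      exact (hc.comp continuousAt_fst).continuousWithinAt
    exact (h1.clm_apply continuousOn_snd).clm_apply continuousOn_snd
  have hunit : ∃ c : ℝ, 0 < c ∧ ∀ x ∈ S, ∀ δ ∈ Metric.sphere (0 : E) 1,
      c ≤ fderiv ℝ (fderiv ℝ f) x δ δ := by
    rcases (S ×ˢ Metric.sphere (0 : E) 1).eq_empty_or_nonempty with h | h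
    -- The product is empty when `S` is empty or `E` is trivial; any positive constant serves.
    · exact ⟨1, one_pos, fun x hx δ hδ =>
        absurd (show (x, δ) ∈ S ×ˢ Metric.sphere (0 : E) 1 from ⟨hx, hδ⟩) (by simp [h])⟩
    · obtain ⟨p, hp, hmin⟩ := hK.exists_isMinOn h hcont
      refine ⟨_, hpos p.1 hp.1 p.2 ?_, fun x hx δ hδ => hmin (show (x, δ) ∈ _ from ⟨hx, hδ⟩)⟩
      intro h0
      have := hp.2
      simp [h0] at this
  obtain ⟨c, hc, hcS⟩ := hunit
  refine ⟨c, hc, fun x hx δ => ?_⟩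
  rcases eq_or_ne δ 0 with rfl | hδ
  · simp
  · have hn : 0 < ‖δ‖ := norm_pos_iff.2 hδ
    have h := hcS x hx (‖δ‖⁻¹ • δ) (by simp [norm_smul, hn.ne'])
    simp only [map_smul, FunLike.coe_smul, Pi.smul_apply, smul_eq_mul] at h
    have h2 := mul_le_mul_of_nonneg_right h (sq_nonneg ‖δ‖)
    calc c * ‖δ‖ ^ 2 ≤ _ := h2
      _ = _ := by field_simp

/-- The derivative is bounded on the compact set, and convexity of `S` makes the mean value
inequality applicable between any two of its points. -/
theorem exists_lipschitzOnWith_of_contDiffAt {F : Type*} [NormedAddCommGroup F] [NormedSpace ℝ F]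
    {g : E → F} {S : Set E} (hS : IsCompact S) (hconv : Convex ℝ S)
    (hg : ∀ x ∈ S, ContDiffAt ℝ 1 g x) : ∃ K : NNReal, LipschitzOnWith K g S := by
  have hcont : ContinuousOn (fderiv ℝ g) S := fun x hx =>
    ((hg x hx).fderiv_right (m := 0) (by norm_num)).continuousAt.continuousWithinAt
  obtain ⟨C, hC⟩ := hS.exists_bound_of_continuousOn hcont
  refine ⟨C.toNNReal, hconv.lipschitzOnWith_of_nnnorm_fderiv_le
    (fun x hx => (hg x hx).differentiableAt (by norm_num)) fun x hx => ?_⟩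
  rw [← NNReal.coe_le_coe, coe_nnnorm]
  exact (hC x hx).trans (Real.le_coe_toNNReal C)

theorem exists_lipschitzOnWith_hessian {S : Set E} (hS : IsCompact S)
    (hconv : Convex ℝ S) (hf : ∀ x ∈ S, ContDiffAt ℝ 3 f x) :
    ∃ K : NNReal, LipschitzOnWith K (fderiv ℝ (fderiv ℝ f)) S :=
  exists_lipschitzOnWith_of_contDiffAt hS hconv fun x hx =>
    ((hf x hx).fderiv_right (m := 2) (by norm_num)).fderiv_right (m := 1) (by norm_num)

end StrictlyConvex

/-! ### Newton's method with backtracking in an abstract finite-dimensional space. -/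

section NewtonMethod

variable {E : Type*} [NormedAddCommGroup E] [NormedSpace ℝ E]

/-- The acceptance test of the backtracking line search for a function `f` with domain `U`. -/
def LineSearchAccepts (f : E → ℝ) (U : Set E) (α : ℝ) (x Δ : E) (t : ℝ) : Prop :=
  x + t • Δ ∈ U ∧ f (x + t • Δ) < f x + α * t * fderiv ℝ f x Δ

/-- One step of Newton's method with backtracking, for a function `f` with domain `U`. -/
def IsBacktrackingNewtonStep (f : E → ℝ) (U : Set E) (α : ℝ) (x x' : E) : Prop :=
  ∃ (Δ : E) (k : ℕ),
    (∀ δ, fderiv ℝ (fderiv ℝ f) x Δ δ = -fderiv ℝ f x δ) ∧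
    LineSearchAccepts f U α x Δ ((1 / 2 : ℝ) ^ k) ∧
    (∀ j < k, ¬ LineSearchAccepts f U α x Δ ((1 / 2 : ℝ) ^ j)) ∧
    x' = x + ((1 / 2 : ℝ) ^ k) • Δ

/-- A sequence generated by Newton's method with backtracking, started at `x₀`. -/
def IsBacktrackingNewtonSequence (f : E → ℝ) (U : Set E) (α : ℝ) (x₀ : E) (x : ℕ → E) : Prop :=
  x 0 = x₀ ∧ ∀ i,
    (fderiv ℝ f (x i) = 0 → x (i + 1) = x i) ∧
    (fderiv ℝ f (x i) ≠ 0 → IsBacktrackingNewtonStep f U α (x i) (x (i + 1)))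

variable {f : E → ℝ} {U : Set E} {α : ℝ}

/-- A positive definite bilinear form on a finite-dimensional space is nondegenerate. -/
theorem exists_equiv_of_pos [FiniteDimensional ℝ E] (H : E →L[ℝ] E →L[ℝ] ℝ)
    (hpos : ∀ δ, δ ≠ 0 → 0 < H δ δ) : ∃ e : E ≃L[ℝ] (E →L[ℝ] ℝ), (e : E →L[ℝ] E →L[ℝ] ℝ) = H := by
  have hinj : Function.Injective (H : E →ₗ[ℝ] E →L[ℝ] ℝ) := by
    rw [injective_iff_map_eq_zero]
    intro δ hδ
    by_contra h
    have := hpos δ h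
    have hδ' : H δ = 0 := hδ
    simp [hδ'] at this
  have hdim : Module.finrank ℝ E = Module.finrank ℝ (E →L[ℝ] ℝ) := by
    rw [← (LinearMap.toContinuousLinearMap (𝕜 := ℝ) (E := E) (F' := ℝ)).finrank_eq]
    exact Subspace.dual_finrank_eq.symm
  refine ⟨(LinearEquiv.ofInjectiveOfFinrankEq _ hinj hdim).toContinuousLinearEquiv, ?_⟩
  ext δ η
  rfl

/-- The Newton direction. -/
noncomputable def newtonDirection (f : E → ℝ) (x : E) : E :=
  -- `ContinuousLinearMap.inverse` is total, with value `0` at noninvertible maps; it is the true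
  -- inverse wherever the Hessian is positive definite.
  -(fderiv ℝ (fderiv ℝ f) x).inverse (fderiv ℝ f x)

theorem hessian_apply_eq_neg_grad_iff [FiniteDimensional ℝ E] {x Δ : E}
    (hpos : ∀ δ, δ ≠ 0 → 0 < fderiv ℝ (fderiv ℝ f) x δ δ) :
    (∀ δ, fderiv ℝ (fderiv ℝ f) x Δ δ = -fderiv ℝ f x δ) ↔ Δ = newtonDirection f x := by
  obtain ⟨e, he⟩ := exists_equiv_of_pos _ hpos
  rw [newtonDirection, ← he, ContinuousLinearMap.inverse_equiv]
  have h1 : (∀ δ, (e : E →L[ℝ] E →L[ℝ] ℝ) Δ δ = -fderiv ℝ f x δ) ↔ e Δ = -fderiv ℝ f x := by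
    rw [ContinuousLinearMap.ext_iff]
    rfl
  rw [h1, ← map_neg]
  exact (ContinuousLinearEquiv.eq_symm_apply e).symm

/-- Inversion of continuous linear maps is smooth near an invertible one, and the Hessian and
gradient vary continuously. -/
theorem continuousAt_newtonDirection [FiniteDimensional ℝ E] {x : E} (hf : ContDiffAt ℝ 3 f x)
    (hpos : ∀ δ, δ ≠ 0 → 0 < fderiv ℝ (fderiv ℝ f) x δ δ) :
    ContinuousAt (newtonDirection f) x := by
  obtain ⟨e, he⟩ := exists_equiv_of_pos _ hpos
  have : CompleteSpace E := FiniteDimensional.complete ℝ E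
  have h1 : ContDiffAt ℝ 2 (fderiv ℝ f) x := hf.fderiv_right (by norm_num)
  have h2 : ContDiffAt ℝ 1 (fderiv ℝ (fderiv ℝ f)) x := h1.fderiv_right (by norm_num)
  have h3 := contDiffAt_map_inverse (n := 1) e
  rw [he] at h3
  have h4 : ContDiffAt ℝ 1 (fun y => (fderiv ℝ (fderiv ℝ f) y).inverse) x := h3.comp x h2
  exact (h4.clm_apply (h1.of_le (by norm_num))).neg.continuousAt

/-- The Newton equation gives slope `-H(Δ, Δ)` along `Δ`, and `Δ ≠ 0` since the gradient is not
zero. -/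
theorem fderiv_newtonDirection_neg [FiniteDimensional ℝ E] {x : E}
    (hpos : ∀ δ, δ ≠ 0 → 0 < fderiv ℝ (fderiv ℝ f) x δ δ) (hx : fderiv ℝ f x ≠ 0) :
    fderiv ℝ f x (newtonDirection f x) < 0 := by
  have h := (hessian_apply_eq_neg_grad_iff hpos).2 rfl
  have h0 : newtonDirection f x ≠ 0 := by
    intro h0
    apply hx
    ext δ
    have := h δ
    rw [h0] at this
    simp at this
    simpa using this
  have := hpos _ h0
  rw [h] at this
  linarith

/-- A descent direction is accepted after finitely many halvings. -/
theorem exists_lineSearchAccepts (hU : IsOpen U) {x Δ : E} (hx : x ∈ U)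
    (hf : DifferentiableAt ℝ f x) (hα : α < 1) (hΔ : fderiv ℝ f x Δ < 0) :
    ∃ k : ℕ, LineSearchAccepts f U α x Δ ((1 / 2 : ℝ) ^ k) := by
  have hline : HasDerivAt (fun s : ℝ => x + s • Δ) Δ 0 := by
    simpa using ((hasDerivAt_id (0 : ℝ)).smul_const Δ).const_add x
  have hd : HasDerivAt (fun s : ℝ => f (x + s • Δ)) (fderiv ℝ f x Δ) 0 := by
    have hf' : HasFDerivAt f (fderiv ℝ f x) (x + (0 : ℝ) • Δ) := by simpa using hf.hasFDerivAt
    exact hf'.comp_hasDerivAt (0 : ℝ) hline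
  have hslope := hasDerivAt_iff_tendsto_slope.1 hd
  -- The difference quotients tend to the slope `w < 0`, and `w < α w` because `α < 1`.
  have hev : ∀ᶠ t : ℝ in 𝓝[≠] 0,
      slope (fun s : ℝ => f (x + s • Δ)) 0 t < α * fderiv ℝ f x Δ :=
    hslope.eventually_lt_const (by nlinarith)
  have hopen : ∀ᶠ t : ℝ in 𝓝[≠] 0, x + t • Δ ∈ U := by
    refine (hline.continuousAt.eventually ?_).filter_mono nhdsWithin_le_nhds
    simpa using hU.mem_nhds hx
  have htend : Filter.Tendsto (fun k : ℕ => (1 / 2 : ℝ) ^ k) Filter.atTop (𝓝[≠] 0) :=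
    tendsto_nhdsWithin_iff.2 ⟨tendsto_pow_atTop_nhds_zero_of_lt_one (by norm_num) (by norm_num),
      Filter.Eventually.of_forall fun k => by simp⟩
  obtain ⟨k, hk1, hk2⟩ := (htend.eventually (hev.and hopen)).exists
  refine ⟨k, hk2, ?_⟩
  have ht : (0 : ℝ) < (1 / 2 : ℝ) ^ k := by positivity
  rw [slope_def_field] at hk1
  simp only [zero_smul, add_zero, sub_zero] at hk1
  rw [div_lt_iff₀ ht] at hk1
  linarith

/-- Nondegeneracy of the Hessian fixes the direction; the multiplier is fixed as the one with the
least accepted exponent. -/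
theorem existsUnique_newtonStep [FiniteDimensional ℝ E] (hU : IsOpen U) {x : E} (hx : x ∈ U)
    (hf : ContDiffAt ℝ 3 f x) (hpos : ∀ δ, δ ≠ 0 → 0 < fderiv ℝ (fderiv ℝ f) x δ δ)
    (hα : α < 1) (hg : fderiv ℝ f x ≠ 0) :
    ∃! x', IsBacktrackingNewtonStep f U α x x' := by
  classical
  have hex := exists_lineSearchAccepts (α := α) hU hx (hf.differentiableAt (by norm_num)) hα
    (fderiv_newtonDirection_neg hpos hg)
  refine ⟨x + ((1 / 2 : ℝ) ^ (Nat.find hex)) • newtonDirection f x,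
    ⟨_, Nat.find hex, (hessian_apply_eq_neg_grad_iff hpos).2 rfl, Nat.find_spec hex,
      fun j hj => Nat.find_min hex hj, rfl⟩, ?_⟩
  rintro x' ⟨Δ, k, hΔ, hk, hmin, rfl⟩
  rw [(hessian_apply_eq_neg_grad_iff hpos).1 hΔ] at hk hmin ⊢
  rw [(Nat.find_eq_iff hex).2 ⟨hk, fun j hj => hmin j hj⟩]

theorem IsBacktrackingNewtonStep.mem_and_lt [FiniteDimensional ℝ E] {x x' : E}
    (hpos : ∀ δ, δ ≠ 0 → 0 < fderiv ℝ (fderiv ℝ f) x δ δ)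
    (hα : 0 < α) (hg : fderiv ℝ f x ≠ 0) (h : IsBacktrackingNewtonStep f U α x x') :
    x' ∈ U ∧ f x' < f x := by
  obtain ⟨Δ, k, hΔ, hk, -, rfl⟩ := h
  rw [(hessian_apply_eq_neg_grad_iff hpos).1 hΔ] at hk ⊢
  refine ⟨hk.1, hk.2.trans ?_⟩
  have h1 := fderiv_newtonDirection_neg hpos hg
  have h2 : 0 < α * (1 / 2 : ℝ) ^ k := by positivity
  nlinarith

/-- Near a noncritical point, the Newton steps decrease the function by a fixed amount. -/
theorem eventually_newtonStep_decrease [FiniteDimensional ℝ E] (hU : IsOpen U) {x : E} (hx : x ∈ U)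
    (hf : ∀ x ∈ U, ContDiffAt ℝ 3 f x)
    (hpos : ∀ x ∈ U, ∀ δ : E, δ ≠ 0 → 0 < fderiv ℝ (fderiv ℝ f) x δ δ)
    (hα0 : 0 < α) (hα : α < 1) (hg : fderiv ℝ f x ≠ 0) :
    ∃ η : ℝ, 0 < η ∧ ∀ᶠ y in 𝓝 x, fderiv ℝ f y ≠ 0 ∧
      ∀ y', IsBacktrackingNewtonStep f U α y y' → f y' + η ≤ f y := by
  have hfx := hf x hx
  have hdc : ContinuousAt (fun y => fderiv ℝ f y) x :=
    (hfx.fderiv_right (m := 2) (by norm_num)).continuousAt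
  have hnc := continuousAt_newtonDirection hfx (hpos x hx)
  have hsc : ContinuousAt (fun y => fderiv ℝ f y (newtonDirection f y)) x := hdc.clm_apply hnc
  have hneg := fderiv_newtonDirection_neg (hpos x hx) hg
  obtain ⟨k, hkU, hk⟩ := exists_lineSearchAccepts (α := α) hU hx
    (hfx.differentiableAt (by norm_num)) hα hneg
  set s : ℝ := (1 / 2 : ℝ) ^ k with hs
  have hs0 : 0 < s := by positivity
  have hmove : ContinuousAt (fun y => y + s • newtonDirection f y) x :=
    continuousAt_id.add (hnc.const_smul s)
  have hmoveU : ∀ᶠ y in 𝓝 x, y + s • newtonDirection f y ∈ U :=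
    hmove.eventually (hU.mem_nhds hkU)
  have hfm : ContinuousAt (fun y => f (y + s • newtonDirection f y)) x :=
    ContinuousAt.comp (f := fun y => y + s • newtonDirection f y) (g := f)
      (hf _ hkU).continuousAt hmove
  have hacc : ∀ᶠ y in 𝓝 x, f (y + s • newtonDirection f y) <
      f y + α * s * fderiv ℝ f y (newtonDirection f y) :=
    hfm.eventually_lt (hfx.continuousAt.add (continuousAt_const.mul hsc)) hk
  have hhalf : ∀ᶠ y in 𝓝 x, fderiv ℝ f y (newtonDirection f y) <
      fderiv ℝ f x (newtonDirection f x) / 2 :=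
    hsc.eventually_lt_const (by linarith)
  -- `s` is a multiplier accepted at `x`. By continuity it is still accepted at nearby `y`, where
  -- the slope is below half of its value at `x`. Backtracking from `y` thus stops at some `t ≥ s`,
  -- which guarantees this decrease.
  refine ⟨α * s * (-(fderiv ℝ f x (newtonDirection f x)) / 2), by
    have : 0 < -(fderiv ℝ f x (newtonDirection f x)) / 2 := by linarith
    positivity, ?_⟩
  filter_upwards [hmoveU, hacc, hhalf, hU.mem_nhds hx, hdc.eventually_ne hg] with y h1 h2 h3 h4 h5
  refine ⟨h5, ?_⟩
  rintro y' ⟨Δ, j, hΔ, hj, hmin, rfl⟩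
  rw [(hessian_apply_eq_neg_grad_iff (hpos y h4)).1 hΔ] at hj hmin ⊢
  have hjk : j ≤ k := by
    by_contra hlt
    exact hmin k (not_le.1 hlt) ⟨h1, h2⟩
  have hjs : s ≤ (1 / 2 : ℝ) ^ j := pow_le_pow_of_le_one (by norm_num) (by norm_num) hjk
  have h6 := hj.2
  set t : ℝ := (1 / 2 : ℝ) ^ j
  set w := fderiv ℝ f y (newtonDirection f y)
  set w₀ := fderiv ℝ f x (newtonDirection f x)
  have h7 : α * t * w ≤ α * s * w := by
    have : α * s ≤ α * t := mul_le_mul_of_nonneg_left hjs hα0.le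
    nlinarith
  have h8 : α * s * w ≤ α * s * (w₀ / 2) := mul_le_mul_of_nonneg_left h3.le (by positivity)
  have h9 : α * s * (-w₀ / 2) = -(α * s * (w₀ / 2)) := by ring
  linarith

/-- Global convergence of Newton's method with backtracking, for a function with positive definite
Hessian on an open convex set and compact sublevel set of the starting point. -/
theorem exists_minimum_and_newton_tendsto [FiniteDimensional ℝ E] (hU : IsOpen U)
    (hconv : Convex ℝ U) (hf : ∀ x ∈ U, ContDiffAt ℝ 3 f x)
    (hpos : ∀ x ∈ U, ∀ δ : E, δ ≠ 0 → 0 < fderiv ℝ (fderiv ℝ f) x δ δ)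
    {x₀ : E} (hx₀ : x₀ ∈ U) (hS : IsCompact {x | x ∈ U ∧ f x ≤ f x₀}) :
    ∃ xm ∈ U, (∀ x ∈ U, f xm ≤ f x) ∧
      (∀ x' ∈ U, (∀ x ∈ U, f x' ≤ f x) → x' = xm) ∧
      ∀ α : ℝ, 0 < α → α < 1 →
        (∃! x : ℕ → E, IsBacktrackingNewtonSequence f U α x₀ x) ∧
        ∀ x : ℕ → E, IsBacktrackingNewtonSequence f U α x₀ x →
          Filter.Tendsto x Filter.atTop (𝓝 xm) := by
  set S := {x | x ∈ U ∧ f x ≤ f x₀} with hSdef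
  have hfc : ContinuousOn f S := fun x hx => (hf x hx.1).continuousAt.continuousWithinAt
  obtain ⟨xm, hxmS, hxm⟩ := hS.exists_isMinOn ⟨x₀, hx₀, le_rfl⟩ hfc
  have hmin : ∀ x ∈ U, f xm ≤ f x := by
    intro x hx
    rcases le_or_gt (f x) (f x₀) with h | h
    · exact hxm (show x ∈ S from ⟨hx, h⟩)
    · exact hxmS.2.trans h.le
  -- At a critical point the tangent plane is horizontal, so the strict tangent inequality makes
  -- that point the only minimizer.
  have hcrit : ∀ x ∈ U, fderiv ℝ f x = 0 → x = xm := by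
    intro x hx hg
    by_contra h
    have := add_fderiv_sub_lt_of_hessian_pos hconv hf hpos hx hxmS.1 (Ne.symm h)
    rw [hg] at this
    simp at this
    exact absurd (hmin x hx) (not_le.2 this)
  refine ⟨xm, hxmS.1, hmin, ?_, ?_⟩
  · intro x' hx' hmin'
    refine hcrit x' hx' (IsLocalMin.fderiv_eq_zero ?_)
    filter_upwards [hU.mem_nhds hx'] with y hy using hmin' y hy
  intro α hα0 hα
  classical
  have hstep : ∀ x ∈ U, fderiv ℝ f x ≠ 0 → ∃! x', IsBacktrackingNewtonStep f U α x x' :=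
    fun x hx hg => existsUnique_newtonStep hU hx (hf x hx) (hpos x hx) hα hg
  have hseqS : ∀ x : ℕ → E, IsBacktrackingNewtonSequence f U α x₀ x →
      ∀ i, x i ∈ S ∧ f (x (i + 1)) ≤ f (x i) := by
    intro x hx
    have hone : ∀ i, x i ∈ S → x (i + 1) ∈ U ∧ f (x (i + 1)) ≤ f (x i) := by
      intro i hi
      by_cases hg : fderiv ℝ f (x i) = 0
      · rw [(hx.2 i).1 hg]
        exact ⟨hi.1, le_rfl⟩
      · have h := ((hx.2 i).2 hg).mem_and_lt (hpos _ hi.1) hα0 hg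
        exact ⟨h.1, h.2.le⟩
    have hall : ∀ i, x i ∈ S := by
      intro i
      induction i with
      | zero => rw [hx.1]; exact ⟨hx₀, le_rfl⟩
      | succ i ih => exact ⟨(hone i ih).1, (hone i ih).2.trans ih.2⟩
    exact fun i => ⟨hall i, (hone i (hall i)).2⟩
  refine ⟨?_, ?_⟩
  -- The outer test only makes the iteration map total; critical points are fixed in either branch.
  · let next : E → E := fun x =>
      if h : ∃ x', IsBacktrackingNewtonStep f U α x x' then
        (if fderiv ℝ f x = 0 then x else h.choose) else x
    let seq : ℕ → E := fun i => next^[i] x₀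
    have hseq_succ : ∀ i, seq (i + 1) = next (seq i) := fun i =>
      Function.iterate_succ_apply' next i x₀
    have hnext0 : ∀ x, fderiv ℝ f x = 0 → next x = x := by
      intro x hg
      simp only [next, hg, if_true]
      split_ifs <;> rfl
    have hnext1 : ∀ x ∈ U, fderiv ℝ f x ≠ 0 → IsBacktrackingNewtonStep f U α x (next x) := by
      intro x hx hg
      have h := (hstep x hx hg).exists
      simp only [next, dif_pos h, if_neg hg]
      exact h.choose_spec
    have hmem : ∀ i, seq i ∈ U := by
      intro i
      induction i with
      | zero => exact hx₀
      | succ i ih =>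
        rw [hseq_succ]
        by_cases hg : fderiv ℝ f (seq i) = 0
        · rwa [hnext0 _ hg]
        · exact ((hnext1 _ ih hg).mem_and_lt (hpos _ ih) hα0 hg).1
    have hseq : IsBacktrackingNewtonSequence f U α x₀ seq :=
      ⟨rfl, fun i => ⟨fun hg => by rw [hseq_succ, hnext0 _ hg],
        fun hg => by rw [hseq_succ]; exact hnext1 _ (hmem i) hg⟩⟩
    refine ⟨seq, hseq, fun x hx => funext fun i => ?_⟩
    induction i with
    | zero => rw [hx.1, hseq.1]
    | succ i ih =>
      by_cases hg : fderiv ℝ f (seq i) = 0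
      · rw [(hseq.2 i).1 hg, (hx.2 i).1 (by rw [ih]; exact hg), ih]
      · have h1 := (hx.2 i).2 (by rw [ih]; exact hg)
        rw [ih] at h1
        exact (hstep _ (hmem i) hg).unique h1 ((hseq.2 i).2 hg)
  · intro x hx
    have hxS := hseqS x hx
    have hanti : Antitone fun i => f (x i) := antitone_nat_of_succ_le fun i => (hxS i).2
    have hlim := tendsto_atTop_ciInf hanti ⟨f xm, by
      rintro _ ⟨i, rfl⟩
      exact hmin _ (hxS i).1.1⟩
    have hdiff : Filter.Tendsto (fun i => f (x i) - f (x (i + 1))) Filter.atTop (𝓝 0) := by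
      simpa using hlim.sub (hlim.comp (Filter.tendsto_add_atTop_nat 1))
    -- In a compact set it suffices that `xm` is the only cluster point. A noncritical cluster point
    -- would force a decrease of at least `η` infinitely often, whereas consecutive differences of
    -- the values tend to `0`.
    refine hS.tendsto_nhds_of_unique_mapClusterPt
      (Filter.Eventually.of_forall fun i => (hxS i).1) ?_
    intro y hy hcl
    by_contra hne
    have hg : fderiv ℝ f y ≠ 0 := fun hg => hne (hcrit y hy.1 hg)
    obtain ⟨η, hη, hev⟩ := eventually_newtonStep_decrease hU hy.1 hf hpos hα0 hα hg
    have hfreq := hcl.frequently hev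
    obtain ⟨i, hi1, hi2⟩ := (hfreq.and_eventually (hdiff.eventually_lt_const hη)).exists
    have := hi1.2 _ ((hx.2 i).2 hi1.1)
    linarith

end NewtonMethod

/-! ### Calculus of the inverse in a Banach algebra. -/

section InverseFunctional

variable {E R : Type*} [NormedAddCommGroup E] [NormedSpace ℝ E] [NormedRing R] [NormedAlgebra ℝ R]
  [CompleteSpace R] (T : E →L[ℝ] R) (L : R →L[ℝ] ℝ) (τ : E →L[ℝ] ℝ)

/-- The functional `x ↦ L ((1 + T x)⁻¹) + τ x`. -/
noncomputable def inverseFunctional (x : E) : ℝ :=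
  L (Ring.inverse (1 + T x)) + τ x

variable {T}

theorem hasFDerivAt_inverse_one_add {x : E} (hx : IsUnit (1 + T x)) :
    HasFDerivAt (fun y => Ring.inverse (1 + T y))
      ((-ContinuousLinearMap.mulLeftRight ℝ R (Ring.inverse (1 + T x))
        (Ring.inverse (1 + T x))) ∘L T) x := by
  obtain ⟨u, hu⟩ := hx
  have h := hasFDerivAt_ringInverse (𝕜 := ℝ) u
  rw [← Ring.inverse_unit, hu] at h
  exact h.comp x (T.hasFDerivAt.const_add 1)

theorem contDiffAt_inverseFunctional {x : E} (hx : IsUnit (1 + T x)) (k : ℕ∞) :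
    ContDiffAt ℝ k (inverseFunctional T L τ) x := by
  obtain ⟨u, hu⟩ := hx
  have h := contDiffAt_ringInverse (n := (k : WithTop ℕ∞)) ℝ u
  rw [hu] at h
  have h2 : ContDiffAt ℝ k (fun y => 1 + T y) x := contDiffAt_const.add T.contDiff.contDiffAt
  exact (L.contDiff.contDiffAt.comp x (h.comp x h2)).add τ.contDiff.contDiffAt

theorem fderiv_inverseFunctional_apply {x : E} (hx : IsUnit (1 + T x)) (δ : E) :
    fderiv ℝ (inverseFunctional T L τ) x δ =
      -L (Ring.inverse (1 + T x) * T δ * Ring.inverse (1 + T x)) + τ δ := by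
  have h := (L.hasFDerivAt.comp x (hasFDerivAt_inverse_one_add hx)).add τ.hasFDerivAt
  have h' : HasFDerivAt (inverseFunctional T L τ) _ x := h
  rw [h'.fderiv]
  simp

/-- With `δ` frozen, the first derivative is `-L(i Tδ i) + τ δ` with `i` the inverse. It suffices to
differentiate this once more along `δ`; the product rule gives two equal terms. -/
theorem fderiv_fderiv_inverseFunctional_apply {x : E} (hx : IsUnit (1 + T x)) (δ : E) :
    fderiv ℝ (fderiv ℝ (inverseFunctional T L τ)) x δ δ =
      2 * L (Ring.inverse (1 + T x) * T δ * Ring.inverse (1 + T x) * T δ *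
        Ring.inverse (1 + T x)) := by
  have hd : DifferentiableAt ℝ (fderiv ℝ (inverseFunctional T L τ)) x :=
    ((contDiffAt_inverseFunctional L τ hx 2).fderiv_right (m := 1)
      (by norm_num)).differentiableAt (by norm_num)
  have h1 : fderiv ℝ (fderiv ℝ (inverseFunctional T L τ)) x δ δ =
      fderiv ℝ (fun y => fderiv ℝ (inverseFunctional T L τ) y δ) x δ := by
    rw [fderiv_clm_apply hd (differentiableAt_const δ)]
    simp
  have hev : (fun y => fderiv ℝ (inverseFunctional T L τ) y δ) =ᶠ[𝓝 x]
      fun y => -L (Ring.inverse (1 + T y) * T δ * Ring.inverse (1 + T y)) + τ δ := by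
    have hc : ContinuousAt (fun y => 1 + T y) x := (continuous_const.add T.continuous).continuousAt
    filter_upwards [hc.eventually (Units.isOpen.mem_nhds hx)] with y hy
    exact fderiv_inverseFunctional_apply L τ hy δ
  have hi := hasFDerivAt_inverse_one_add hx
  have h2 := ((L.hasFDerivAt.comp x ((hi.mul_const' (T δ)).mul' hi)).neg).add_const (τ δ)
  have h2' : HasFDerivAt
    (fun y => -L (Ring.inverse (1 + T y) * T δ * Ring.inverse (1 + T y)) + τ δ) _ x := h2
  rw [h1, hev.fderiv_eq, h2'.fderiv]
  simp [mul_assoc, two_mul]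

end InverseFunctional

/-! ### Positive matrices: quadratic forms, traces and norms. -/

section MatrixLemmas

variable {m n : ℕ}

/-- The real part of the sesquilinear form of a matrix. -/
def quadForm (M : Matrix (Fin m) (Fin m) ℂ) (v : Fin m → ℂ) : ℝ :=
  (star v ⬝ᵥ M *ᵥ v).re

/-- The Euclidean unit sphere of `ℂᵐ`. -/
def unitVectors (m : ℕ) : Set (Fin m → ℂ) :=
  {v | star v ⬝ᵥ v = 1}

theorem star_dotProduct_self_eq (v : Fin m → ℂ) :
    star v ⬝ᵥ v = ((∑ i, ‖v i‖ ^ 2 : ℝ) : ℂ) := by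
  simp [dotProduct, Complex.conj_mul']

theorem isCompact_unitVectors (m : ℕ) : IsCompact (unitVectors m) := by
  refine Metric.isCompact_of_isClosed_isBounded ?_ ?_
  · exact isClosed_eq (continuous_star.dotProduct continuous_id) continuous_const
  · refine (Metric.isBounded_closedBall (x := (0 : Fin m → ℂ)) (r := 1)).subset ?_
    intro v hv
    rw [mem_closedBall_zero_iff, pi_norm_le_iff_of_nonneg zero_le_one]
    intro i
    have h : star v ⬝ᵥ v = 1 := hv
    rw [star_dotProduct_self_eq] at h
    have h' : ∑ i, ‖v i‖ ^ 2 = 1 := by exact_mod_cast h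
    have := Finset.single_le_sum (f := fun i => ‖v i‖ ^ 2) (fun i _ => sq_nonneg _)
      (Finset.mem_univ i)
    rw [h'] at this
    exact (sq_le_one_iff₀ (norm_nonneg _)).1 this

theorem continuous_quadForm :
    Continuous fun p : Matrix (Fin m) (Fin m) ℂ × (Fin m → ℂ) => quadForm p.1 p.2 := by
  unfold quadForm
  exact Complex.continuous_re.comp
    ((continuous_star.comp continuous_snd).dotProduct (continuous_fst.matrix_mulVec continuous_snd))

theorem quadForm_add (M N : Matrix (Fin m) (Fin m) ℂ) (v : Fin m → ℂ) :
    quadForm (M + N) v = quadForm M v + quadForm N v := by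
  simp [quadForm, Matrix.add_mulVec]

theorem quadForm_sub (M N : Matrix (Fin m) (Fin m) ℂ) (v : Fin m → ℂ) :
    quadForm (M - N) v = quadForm M v - quadForm N v := by
  simp [quadForm, Matrix.sub_mulVec]

theorem exists_unitVector {v : Fin m → ℂ} (hv : v ≠ 0) :
    ∃ (r : ℝ) (u : Fin m → ℂ), 0 < r ∧ u ∈ unitVectors m ∧ v = (r : ℂ) • u := by
  set s : ℝ := ∑ i, ‖v i‖ ^ 2 with hs
  have hs0 : 0 < s := by
    obtain ⟨i, hi⟩ := Function.ne_iff.1 hv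
    refine Finset.sum_pos' (fun i _ => sq_nonneg _) ⟨i, Finset.mem_univ i, ?_⟩
    have : 0 < ‖v i‖ := norm_pos_iff.2 hi
    positivity
  have hr : 0 < Real.sqrt s := Real.sqrt_pos.2 hs0
  have hr' : ((Real.sqrt s : ℝ) : ℂ) ≠ 0 := by exact_mod_cast hr.ne'
  refine ⟨Real.sqrt s, ((Real.sqrt s : ℝ) : ℂ)⁻¹ • v, hr, ?_, by rw [smul_inv_smul₀ hr']⟩
  change star (((Real.sqrt s : ℝ) : ℂ)⁻¹ • v) ⬝ᵥ (((Real.sqrt s : ℝ) : ℂ)⁻¹ • v) = 1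
  rw [star_smul, smul_dotProduct, dotProduct_smul, star_dotProduct_self_eq, ← hs]
  simp only [star_inv₀, Complex.star_def, Complex.conj_ofReal, smul_eq_mul]
  rw [← mul_assoc, ← mul_inv, ← Complex.ofReal_mul, Real.mul_self_sqrt hs0.le]
  exact inv_mul_cancel₀ (by exact_mod_cast hs0.ne')

theorem quadForm_real_smul (M : Matrix (Fin m) (Fin m) ℂ) (r : ℝ) (v : Fin m → ℂ) :
    quadForm M ((r : ℂ) • v) = r ^ 2 * quadForm M v := by
  simp only [quadForm, star_smul, smul_dotProduct, Matrix.mulVec_smul, dotProduct_smul,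
    Complex.star_def, Complex.conj_ofReal, smul_eq_mul, Complex.re_ofReal_mul]
  ring

theorem star_dotProduct_mulVec_eq_quadForm {M : Matrix (Fin m) (Fin m) ℂ} (hM : M.IsHermitian)
    (v : Fin m → ℂ) : star v ⬝ᵥ M *ᵥ v = (quadForm M v : ℂ) := by
  refine Complex.ext rfl ?_
  have := hM.im_star_dotProduct_mulVec_self v
  simpa using this

theorem posDef_of_quadForm_pos {M : Matrix (Fin m) (Fin m) ℂ} (hM : M.IsHermitian)
    (h : ∀ v ∈ unitVectors m, 0 < quadForm M v) : M.PosDef := by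
  refine Matrix.PosDef.of_dotProduct_mulVec_pos hM fun v hv => ?_
  obtain ⟨r, u, hr, hu, rfl⟩ := exists_unitVector hv
  rw [star_dotProduct_mulVec_eq_quadForm hM, quadForm_real_smul]
  have := h u hu
  exact_mod_cast (by positivity : 0 < r ^ 2 * quadForm M u)

theorem posSemidef_of_quadForm_nonneg {M : Matrix (Fin m) (Fin m) ℂ} (hM : M.IsHermitian)
    (h : ∀ v ∈ unitVectors m, 0 ≤ quadForm M v) : M.PosSemidef := by
  refine Matrix.PosSemidef.of_dotProduct_mulVec_nonneg hM fun v => ?_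
  rcases eq_or_ne v 0 with rfl | hv
  · simp
  obtain ⟨r, u, hr, hu, rfl⟩ := exists_unitVector hv
  rw [star_dotProduct_mulVec_eq_quadForm hM, quadForm_real_smul]
  have := h u hu
  exact_mod_cast (by positivity : 0 ≤ r ^ 2 * quadForm M u)

theorem ne_zero_of_mem_unitVectors {v : Fin m → ℂ} (hv : v ∈ unitVectors m) : v ≠ 0 := by
  rintro rfl
  have : star (0 : Fin m → ℂ) ⬝ᵥ 0 = 1 := hv
  simp at this

theorem quadForm_pos {M : Matrix (Fin m) (Fin m) ℂ} (hM : M.PosDef)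
    {v : Fin m → ℂ} (hv : v ∈ unitVectors m) : 0 < quadForm M v :=
  (Complex.lt_def.1 (hM.dotProduct_mulVec_pos (ne_zero_of_mem_unitVectors hv))).1

theorem quadForm_smul_one (c : ℝ) {v : Fin m → ℂ} (hv : v ∈ unitVectors m) :
    quadForm ((c : ℂ) • (1 : Matrix (Fin m) (Fin m) ℂ)) v = c := by
  have h : star v ⬝ᵥ v = 1 := hv
  simp [quadForm, Matrix.smul_mulVec, h]

theorem isHermitian_real_smul_one (c : ℝ) :
    ((c : ℂ) • (1 : Matrix (Fin m) (Fin m) ℂ)).IsHermitian := by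
  rw [Matrix.IsHermitian, Matrix.conjTranspose_smul]
  simp

/-- A continuous family of positive definite matrices over a compact space is coercive. -/
theorem exists_pos_le_of_posDef {X : Type*} [TopologicalSpace X] [CompactSpace X]
    {F : X → Matrix (Fin m) (Fin m) ℂ} (hF : Continuous F) (hpos : ∀ x, (F x).PosDef) :
    ∃ c : ℝ, 0 < c ∧ ∀ x, (F x - (c : ℂ) • (1 : Matrix (Fin m) (Fin m) ℂ)).PosSemidef := by
  have hK : IsCompact ((Set.univ : Set X) ×ˢ unitVectors m) :=
    isCompact_univ.prod (isCompact_unitVectors m)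
  have hc : ContinuousOn (fun p : X × (Fin m → ℂ) => quadForm (F p.1) p.2)
      (Set.univ ×ˢ unitVectors m) :=
    (continuous_quadForm.comp ((hF.comp continuous_fst).prodMk continuous_snd)).continuousOn
  have : ∃ c : ℝ, 0 < c ∧ ∀ x, ∀ v ∈ unitVectors m, c ≤ quadForm (F x) v := by
    rcases ((Set.univ : Set X) ×ˢ unitVectors m).eq_empty_or_nonempty with h | h
    · refine ⟨1, one_pos, fun x v hv => ?_⟩
      have : (x, v) ∈ (Set.univ : Set X) ×ˢ unitVectors m := ⟨trivial, hv⟩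
      simp [h] at this
    · obtain ⟨p, hp, hmin⟩ := hK.exists_isMinOn h hc
      exact ⟨_, quadForm_pos (hpos p.1) hp.2, fun x v hv => hmin (show (x, v) ∈ _ from ⟨trivial, hv⟩)⟩
  obtain ⟨c, hc0, hc⟩ := this
  refine ⟨c, hc0, fun x => posSemidef_of_quadForm_nonneg
    ((hpos x).isHermitian.sub (isHermitian_real_smul_one c)) fun v hv => ?_⟩
  rw [quadForm_sub, quadForm_smul_one c hv]
  linarith [hc x v hv]

open scoped Matrix.Norms.L2Operator MatrixOrder in
-- Write `M = C*C`; cyclicity turns the trace into that of `C N C*`.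
theorem re_trace_mul_nonneg {M N : Matrix (Fin m) (Fin m) ℂ} (hM : M.PosSemidef)
    (hN : N.PosSemidef) : 0 ≤ (M * N).trace.re := by
  obtain ⟨C, rfl⟩ := CStarAlgebra.nonneg_iff_eq_star_mul_self.1 (Matrix.nonneg_iff_posSemidef.2 hM)
  rw [Matrix.star_eq_conjTranspose, Matrix.mul_assoc, Matrix.trace_mul_comm]
  exact (Complex.le_def.1 (hN.mul_mul_conjTranspose_same C).trace_nonneg).1

theorem mul_re_trace_le {M N : Matrix (Fin m) (Fin m) ℂ} {c : ℝ}
    (hM : (M - (c : ℂ) • (1 : Matrix (Fin m) (Fin m) ℂ)).PosSemidef)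
    (hN : N.PosSemidef) : c * N.trace.re ≤ (M * N).trace.re := by
  have h := re_trace_mul_nonneg hM hN
  rw [Matrix.sub_mul, Matrix.trace_sub, Matrix.smul_mul, Matrix.one_mul, Matrix.trace_smul] at h
  simp only [Complex.sub_re, smul_eq_mul, Complex.re_ofReal_mul] at h
  linarith

/-- Completing the square: with `V = v v*` and `s = 1 / (v*Qv)`, the matrix `(1 - sVQ) Q⁻¹ (1 -
sVQ)*` is positive semidefinite, and its trace is `tr Q⁻¹ - s`. -/
theorem inv_quadForm_le_re_trace_inv {Q : Matrix (Fin m) (Fin m) ℂ} (hQ : Q.PosDef)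
    {v : Fin m → ℂ} (hv : v ∈ unitVectors m) : (quadForm Q v)⁻¹ ≤ (Q⁻¹).trace.re := by
  have hq := quadForm_pos hQ hv
  set q := quadForm Q v with hqdef
  set s : ℂ := ((q⁻¹ : ℝ) : ℂ) with hs
  have hv1 : star v ⬝ᵥ v = 1 := hv
  let V : Matrix (Fin m) (Fin m) ℂ := Matrix.vecMulVec v (star v)
  have hVh : Vᴴ = V := by simp [V, Matrix.conjTranspose_vecMulVec]
  have hunit : IsUnit Q.det := (Matrix.isUnit_iff_isUnit_det Q).1 hQ.isUnit
  have htrV : V.trace = 1 := by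
    rw [Matrix.trace_vecMulVec, dotProduct_comm, hv1]
  have hVV : (V * Q * V).trace = q := by
    rw [Matrix.vecMulVec_mul, Matrix.vecMulVec_mul_vecMulVec,
      Matrix.trace_vecMulVec, dotProduct_comm, smul_dotProduct, hv1, ← Matrix.dotProduct_mulVec,
      star_dotProduct_mulVec_eq_quadForm hQ.isHermitian]
    simp [hqdef]
  have hsh : star s = s := by simp [hs]
  have h := (hQ.inv.posSemidef.mul_mul_conjTranspose_same (1 - s • (V * Q))).trace_nonneg
  have hexp : (1 - s • (V * Q)) * Q⁻¹ * (1 - s • (V * Q))ᴴ =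
      Q⁻¹ - s • V - s • V + (s * s) • (V * Q * V) := by
    rw [Matrix.conjTranspose_sub, Matrix.conjTranspose_smul, Matrix.conjTranspose_mul, hVh,
      hQ.isHermitian.eq, hsh, Matrix.conjTranspose_one]
    simp only [Matrix.sub_mul, Matrix.mul_sub, Matrix.one_mul, Matrix.mul_one, Matrix.smul_mul,
      Matrix.mul_smul]
    rw [Matrix.mul_nonsing_inv_cancel_right _ _ hunit, ← Matrix.mul_assoc Q⁻¹,
      Matrix.nonsing_inv_mul _ hunit, Matrix.one_mul, smul_sub, smul_smul, Matrix.mul_assoc V Q V]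
    abel
  rw [hexp, Matrix.trace_add, Matrix.trace_sub, Matrix.trace_sub, Matrix.trace_smul,
    Matrix.trace_smul, htrV, hVV] at h
  have h' := (Complex.le_def.1 h).1
  have h2 : (s * s) • (q : ℂ) = s := by
    rw [smul_eq_mul, hs, mul_assoc, ← Complex.ofReal_mul, inv_mul_cancel₀ hq.ne']
    simp
  rw [h2] at h'
  simp [hs] at h'
  simpa using h'

/-- `1 - v v*` is an orthogonal projection, so its product with `M` has nonnegative trace. -/
theorem quadForm_le_re_trace {M : Matrix (Fin m) (Fin m) ℂ} (hM : M.PosSemidef)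
    {v : Fin m → ℂ} (hv : v ∈ unitVectors m) : quadForm M v ≤ M.trace.re := by
  have hv1 : star v ⬝ᵥ v = 1 := hv
  let V : Matrix (Fin m) (Fin m) ℂ := Matrix.vecMulVec v (star v)
  have hVh : Vᴴ = V := by simp [V, Matrix.conjTranspose_vecMulVec]
  have hVV : V * V = V := by
    rw [Matrix.vecMulVec_mul_vecMulVec, hv1, one_smul]
  have hproj : (1 - V) = (1 - V)ᴴ * (1 - V) := by
    rw [Matrix.conjTranspose_sub, hVh, Matrix.conjTranspose_one]
    simp [Matrix.sub_mul, Matrix.mul_sub, hVV]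
  have hpsd : (1 - V).PosSemidef := by
    rw [hproj]
    exact Matrix.posSemidef_conjTranspose_mul_self _
  have h := re_trace_mul_nonneg hM hpsd
  rw [Matrix.mul_sub, Matrix.mul_one, Matrix.trace_sub, Matrix.mul_vecMulVec,
    Matrix.trace_vecMulVec, dotProduct_comm, Complex.sub_re] at h
  exact sub_nonneg.1 h

theorem posDef_conj_eq_zero {P : Matrix (Fin m) (Fin m) ℂ} (hP : P.PosDef)
    {M : Matrix (Fin m) (Fin m) ℂ} (h : Mᴴ * P * M = 0) : M = 0 := by
  refine Matrix.ext_of_mulVec_single fun i => ?_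
  set x : Fin m → ℂ := Pi.single i 1
  rw [Matrix.zero_mulVec]
  by_contra hx
  have h1 := hP.dotProduct_mulVec_pos hx
  have h2 : star (M *ᵥ x) ⬝ᵥ P *ᵥ M *ᵥ x = star x ⬝ᵥ (Mᴴ * P * M) *ᵥ x := by
    rw [Matrix.star_mulVec, ← Matrix.dotProduct_mulVec, Matrix.mulVec_mulVec, Matrix.mulVec_mulVec, Matrix.mul_assoc]
  rw [h2, h] at h1
  simp at h1

open scoped Matrix.Norms.L2Operator MatrixOrder

/-- For the operator norm this amounts to `M ≤ (tr M) I`, which is checked on unit vectors. -/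
theorem norm_le_re_trace {M : Matrix (Fin m) (Fin m) ℂ} (hM : M.PosSemidef) :
    ‖M‖ ≤ M.trace.re := by
  have ht : 0 ≤ M.trace.re := (Complex.le_def.1 hM.trace_nonneg).1
  rw [CStarAlgebra.norm_le_iff_le_algebraMap M ht (Matrix.nonneg_iff_posSemidef.2 hM),
    Matrix.le_iff, Algebra.algebraMap_eq_smul_one]
  have hsm : M.trace.re • (1 : Matrix (Fin m) (Fin m) ℂ) = ((M.trace.re : ℝ) : ℂ) • 1 := by
    ext i j
    simp
  rw [hsm]
  refine posSemidef_of_quadForm_nonneg ((isHermitian_real_smul_one _).sub hM.isHermitian)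
    fun v hv => ?_
  rw [quadForm_sub, quadForm_smul_one _ hv]
  linarith [quadForm_le_re_trace hM hv]

theorem norm_apply_le (M : Matrix (Fin n) (Fin m) ℂ) (i : Fin n) (j : Fin m) : ‖M i j‖ ≤ ‖M‖ := by
  have h := Matrix.l2_opNorm_mulVec M (EuclideanSpace.single j 1)
  have h2 := (PiLp.norm_apply_le (WithLp.toLp 2 (M *ᵥ Pi.single j 1)) i : _)
  simp at h h2
  exact h2.trans h

theorem abs_quadForm_le (M : Matrix (Fin m) (Fin m) ℂ) {v : Fin m → ℂ} (hv : v ∈ unitVectors m) :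
    |quadForm M v| ≤ ‖M‖ := by
  have hv1 : star v ⬝ᵥ v = 1 := hv
  set w : EuclideanSpace ℂ (Fin m) := WithLp.toLp 2 v with hw
  have hnorm : ‖w‖ = 1 := by
    have h := EuclideanSpace.inner_eq_star_dotProduct w w
    rw [inner_self_eq_norm_sq_to_K, dotProduct_comm] at h
    have h2 : ((‖w‖ ^ 2 : ℝ) : ℂ) = 1 := by
      rw [← hv1]
      simpa using h
    have h3 : ‖w‖ ^ 2 = 1 := by exact_mod_cast h2
    exact (pow_eq_one_iff_of_nonneg (norm_nonneg w) two_ne_zero).1 h3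
  have h1 : quadForm M v = (inner ℂ w (WithLp.toLp 2 (M *ᵥ v))).re := by
    rw [EuclideanSpace.inner_eq_star_dotProduct, dotProduct_comm]
    rfl
  rw [h1]
  refine (Complex.abs_re_le_norm _).trans ((norm_inner_le_norm _ _).trans ?_)
  rw [hnorm, one_mul]
  have := Matrix.l2_opNorm_mulVec M w
  rw [hnorm, mul_one] at this
  exact this

end MatrixLemmas

/-! ### Means over the circle and the functional defined by the density. -/

section CircleMean

variable {m n : ℕ}

/-- The mean over the unit circle of a real-valued function. -/
noncomputable def circleMean (g : Circle → ℝ) : ℝ :=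
  (2 * Real.pi)⁻¹ * ∫ θ in (0 : ℝ)..(2 * Real.pi), g (Circle.exp θ)

/-- Integrability over the unit circle. -/
def CircleInt {F : Type*} [NormedAddCommGroup F] (g : Circle → F) : Prop :=
  IntervalIntegrable (fun θ : ℝ => g (Circle.exp θ)) MeasureTheory.volume 0 (2 * Real.pi)

theorem circleInt_of_continuous {F : Type*} [NormedAddCommGroup F] {g : Circle → F}
    (hg : Continuous g) : CircleInt g :=
  (hg.comp Circle.exp.continuous).intervalIntegrable _ _

theorem CircleInt.re {g : Circle → ℂ} (hg : CircleInt g) : CircleInt fun z => (g z).re :=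
  ⟨hg.1.re, hg.2.re⟩

theorem CircleInt.finset_sum {ι : Type*} {s : Finset ι}
    {g : ι → Circle → ℂ} (hg : ∀ i ∈ s, CircleInt (g i)) : CircleInt fun z => ∑ i ∈ s, g i z := by
  have := IntervalIntegrable.sum s (f := fun i θ => g i (Circle.exp θ)) hg
  have heq : (fun θ : ℝ => ∑ i ∈ s, g i (Circle.exp θ)) = ∑ i ∈ s, fun θ => g i (Circle.exp θ) := by
    ext θ
    simp
  rwa [CircleInt, heq]

theorem circleMean_mono {f g : Circle → ℝ} (hf : CircleInt f) (hg : CircleInt g)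
    (h : ∀ z, f z ≤ g z) : circleMean f ≤ circleMean g :=
  mul_le_mul_of_nonneg_left
    (intervalIntegral.integral_mono_on Real.two_pi_pos.le hf hg fun _ _ => h _)
    (by positivity)

theorem circleMean_add {f g : Circle → ℝ} (hf : CircleInt f) (hg : CircleInt g) :
    circleMean (fun z => f z + g z) = circleMean f + circleMean g := by
  rw [circleMean, intervalIntegral.integral_add hf hg, mul_add]
  rfl

theorem circleMean_sub {f g : Circle → ℝ} (hf : CircleInt f) (hg : CircleInt g) :
    circleMean (fun z => f z - g z) = circleMean f - circleMean g := by
  rw [circleMean, intervalIntegral.integral_sub hf hg, mul_sub]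
  rfl

theorem circleMean_const_mul (c : ℝ) (f : Circle → ℝ) :
    circleMean (fun z => c * f z) = c * circleMean f := by
  rw [circleMean, intervalIntegral.integral_const_mul, circleMean]
  ring

theorem circleMean_const (c : ℝ) : circleMean (fun _ => c) = c := by
  have := Real.pi_pos
  rw [circleMean, intervalIntegral.integral_const]
  simp
  field_simp

/-- Lets the interval of integration start at the argument of any prescribed point of the circle. -/
theorem circleMean_eq_shift (g : Circle → ℝ) (t : ℝ) :
    circleMean g = (2 * Real.pi)⁻¹ * ∫ θ in t..(t + 2 * Real.pi), g (Circle.exp θ) := by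
  have hper : Function.Periodic (fun θ : ℝ => g (Circle.exp θ)) (2 * Real.pi) := by
    intro θ
    simp [Circle.exp_add]
  have := hper.intervalIntegral_add_eq 0 t
  rw [zero_add] at this
  rw [circleMean, this]

theorem circleMean_pos {g : Circle → ℝ} (hg : Continuous g) (h0 : ∀ z, 0 ≤ g z) {z : Circle}
    (hz : 0 < g z) : 0 < circleMean g := by
  rw [circleMean_eq_shift g (Complex.arg z)]
  have hlt : Complex.arg z < Complex.arg z + 2 * Real.pi := by linarith [Real.pi_pos]
  refine mul_pos (by positivity) (intervalIntegral.integral_pos hlt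
    (hg.comp Circle.exp.continuous).continuousOn (fun _ _ => h0 _)
    ⟨Complex.arg z, Set.left_mem_Icc.2 hlt.le, ?_⟩)
  simpa using hz

theorem re_normCircleIntegral_apply {ι κ : Type*} {F : Circle → Matrix ι κ ℂ} {i : ι} {j : κ}
    (hF : CircleInt fun z => F z i j) :
    (normCircleIntegral F i j).re = circleMean fun z => (F z i j).re := by
  rw [normCircleIntegral, Matrix.of_apply, Complex.smul_re, circleMean, smul_eq_mul]
  congr 1
  exact (intervalIntegral.intervalIntegral_re hF).symm

theorem circleMean_finset_sum {ι : Type*} {s : Finset ι}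
    {g : ι → Circle → ℝ} (hg : ∀ i ∈ s, CircleInt (g i)) :
    circleMean (fun z => ∑ i ∈ s, g i z) = ∑ i ∈ s, circleMean (g i) := by
  rw [circleMean, intervalIntegral.integral_finsetSum hg, Finset.mul_sum]
  rfl

theorem re_trace_normCircleIntegral {F : Circle → Matrix (Fin m) (Fin m) ℂ}
    (hF : ∀ i, CircleInt fun z => F z i i) :
    (normCircleIntegral F).trace.re = circleMean fun z => (F z).trace.re := by
  simp only [Matrix.trace, Matrix.diag, Complex.re_sum]
  rw [circleMean_finset_sum fun i _ => (hF i).re]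
  exact Finset.sum_congr rfl fun i _ => re_normCircleIntegral_apply (hF i)

theorem mul_normCircleIntegral (X : Matrix (Fin n) (Fin n) ℂ) {F : Circle → Matrix (Fin n) (Fin n) ℂ}
    (hF : ∀ i j, CircleInt fun z => F z i j) :
    X * normCircleIntegral F = normCircleIntegral fun z => X * F z := by
  ext i j
  simp only [normCircleIntegral, Matrix.mul_apply, Matrix.of_apply]
  rw [intervalIntegral.integral_finsetSum fun k _ => (hF k j).const_mul (X i k), Finset.smul_sum]
  refine Finset.sum_congr rfl fun k _ => ?_
  rw [intervalIntegral.integral_const_mul, mul_smul_comm]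

theorem circleInt_apply_of_continuous {ι κ : Type*} {F : Circle → Matrix ι κ ℂ}
    (hF : Continuous F) (i : ι) (j : κ) : CircleInt fun z => F z i j :=
  circleInt_of_continuous (hF.matrix_elem i j)

theorem IsSpectralDensity.circleInt {Ψ : Circle → Matrix (Fin m) (Fin m) ℂ}
    (hΨ : IsSpectralDensity Ψ) (i j : Fin m) : CircleInt fun z => Ψ z i j := by
  obtain ⟨M, hM⟩ := hΨ.bounded
  refine (intervalIntegrable_const (c := M)).mono_fun (hΨ.measurable i j).aestronglyMeasurable ?_
  refine Filter.Eventually.of_forall fun θ => (hM _ i j).trans (le_abs_self M)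

theorem IsSpectralDensity.circleInt_mul {Ψ : Circle → Matrix (Fin m) (Fin m) ℂ}
    (hΨ : IsSpectralDensity Ψ) {F : Circle → Matrix (Fin m) (Fin m) ℂ} (hF : Continuous F)
    (i j : Fin m) : CircleInt fun z => (F z * Ψ z) i j := by
  simp only [Matrix.mul_apply]
  refine CircleInt.finset_sum fun k _ => ?_
  exact (hΨ.circleInt k j).continuousOn_mul
    ((hF.matrix_elem i k).comp Circle.exp.continuous).continuousOn

theorem circleInt_re_trace {F : Circle → Matrix (Fin m) (Fin m) ℂ}
    (hF : ∀ i, CircleInt fun z => F z i i) : CircleInt fun z => (F z).trace.re :=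
  (CircleInt.finset_sum fun i _ => hF i).re

open scoped Matrix.Norms.L2Operator

/-- The linear functional `F ↦ Re tr ∫ F Ψ` on the continuous matrix-valued functions. -/
noncomputable def densityFunctional {Ψ : Circle → Matrix (Fin m) (Fin m) ℂ}
    (hΨ : IsSpectralDensity Ψ) : C(Circle, Matrix (Fin m) (Fin m) ℂ) →L[ℝ] ℝ :=
  LinearMap.mkContinuousOfExistsBound
    { toFun := fun F => circleMean fun z => (F z * Ψ z).trace.re
      map_add' := fun F₁ F₂ => by
        rw [← circleMean_add (circleInt_re_trace fun i => hΨ.circleInt_mul F₁.continuous i i)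
          (circleInt_re_trace fun i => hΨ.circleInt_mul F₂.continuous i i)]
        simp [Matrix.add_mul]
      map_smul' := fun r F => by
        rw [RingHom.id_apply, smul_eq_mul, ← circleMean_const_mul]
        simp }
    (by
      obtain ⟨M, hM⟩ := hΨ.bounded
      have hM0 : 0 ≤ |M| := abs_nonneg M
      -- The trace of the product is a sum of `m²` products of entries, each at most `‖F‖ |M|`.
      refine ⟨m * (m * |M|), fun F => ?_⟩
      have hint := circleInt_re_trace fun i => hΨ.circleInt_mul F.continuous i i
      have hpt : ∀ z, |(F z * Ψ z).trace.re| ≤ m * (m * |M|) * ‖F‖ := by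
        intro z
        refine (Complex.abs_re_le_norm _).trans ?_
        simp only [Matrix.trace, Matrix.diag, Matrix.mul_apply]
        refine (norm_sum_le _ _).trans ?_
        have : ∀ i j, ‖F z i j * Ψ z j i‖ ≤ ‖F‖ * |M| := fun i j => by
          rw [norm_mul]
          exact mul_le_mul ((norm_apply_le _ _ _).trans (F.norm_coe_le_norm z))
            ((hM z j i).trans (le_abs_self M)) (norm_nonneg _) (norm_nonneg _)
        refine (Finset.sum_le_sum fun i _ => (norm_sum_le _ _).trans
          (Finset.sum_le_sum fun j _ => this i j)).trans ?_
        simp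
        apply le_of_eq
        ring
      rw [Real.norm_eq_abs, abs_le]
      constructor
      · have := circleMean_mono (circleInt_of_continuous continuous_const) hint
          fun z => (abs_le.1 (hpt z)).1
        rwa [circleMean_const] at this
      · have := circleMean_mono hint (circleInt_of_continuous continuous_const)
          fun z => (abs_le.1 (hpt z)).2
        rwa [circleMean_const] at this)

theorem densityFunctional_apply {Ψ : Circle → Matrix (Fin m) (Fin m) ℂ}
    (hΨ : IsSpectralDensity Ψ) (F : C(Circle, Matrix (Fin m) (Fin m) ℂ)) :
    densityFunctional hΨ F = circleMean fun z => (F z * Ψ z).trace.re := rfl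

theorem isUnit_of_posDef {F : C(Circle, Matrix (Fin m) (Fin m) ℂ)} (hF : ∀ z, (F z).PosDef) :
    IsUnit F :=
  (ContinuousMap.isUnit_iff_forall_isUnit F).2 fun z => (hF z).isUnit

theorem inverse_apply {F : C(Circle, Matrix (Fin m) (Fin m) ℂ)} (hF : IsUnit F) (z : Circle) :
    Ring.inverse F z = (F z)⁻¹ := by
  symm
  refine Matrix.inv_eq_right_inv ?_
  rw [← ContinuousMap.mul_apply, Ring.mul_inverse_cancel _ hF, ContinuousMap.one_apply]

end CircleMean

/-! ### The functional `J`: domain, smoothness and positive Hessian. -/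

section DualFunctional

variable {m n : ℕ} {A : Matrix (Fin n) (Fin n) ℂ} {B : Matrix (Fin n) (Fin m) ℂ} {hA : IsStable A}

instance RangeGamma.finiteDimensional : FiniteDimensional ℝ (RangeGamma A B hA) :=
  inferInstanceAs (FiniteDimensional ℝ (LinearMap.range (Gamma A B hA)))

/-- The inclusion of `Range Γ` into the space of all matrices. -/
noncomputable def RangeGamma.toMatrixLinear :
    RangeGamma A B hA →ₗ[ℝ] Matrix (Fin n) (Fin n) ℂ where
  toFun := RangeGamma.toMatrix
  map_add' _ _ := rfl
  map_smul' _ _ := rfl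

theorem RangeGamma.toMatrix_add (Λ Λ' : RangeGamma A B hA) :
    (Λ + Λ').toMatrix = Λ.toMatrix + Λ'.toMatrix := rfl

theorem RangeGamma.toMatrix_smul (r : ℝ) (Λ : RangeGamma A B hA) :
    (r • Λ).toMatrix = r • Λ.toMatrix := rfl

theorem RangeGamma.toMatrix_zero : (0 : RangeGamma A B hA).toMatrix = 0 := rfl

theorem RangeGamma.eq_zero_of_toMatrix {Λ : RangeGamma A B hA} (h : Λ.toMatrix = 0) : Λ = 0 :=
  Subtype.ext h

theorem RangeGamma.exists_eq (Λ : RangeGamma A B hA) : ∃ Φ, Gamma A B hA Φ = Λ.toMatrix :=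
  Λ.2

theorem RangeGamma.isHermitian (Λ : RangeGamma A B hA) : Λ.toMatrix.IsHermitian := by
  obtain ⟨Φ, hΦ⟩ := Λ.exists_eq
  rw [← hΦ]
  exact isHermitian_Gamma A B hA Φ

theorem continuous_toMatrix : Continuous fun Λ : RangeGamma A B hA => Λ.toMatrix :=
  (RangeGamma.toMatrixLinear (A := A) (B := B) (hA := hA)).continuous_of_finiteDimensional

open scoped Matrix.Norms.L2Operator

variable (A B hA) in
/-- The map `Λ ↦ G* Λ G` into the continuous matrix-valued functions on the circle. -/
noncomputable def sandwichMap : RangeGamma A B hA →L[ℝ] C(Circle, Matrix (Fin m) (Fin m) ℂ) :=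
  LinearMap.toContinuousLinearMap
    { toFun := fun Λ => ⟨fun z => (transfer A B z)ᴴ * Λ.toMatrix * transfer A B z,
        ((continuous_transfer hA B).matrix_conjTranspose.matrix_mul
          continuous_const).matrix_mul (continuous_transfer hA B)⟩
      map_add' := fun Λ₁ Λ₂ => by
        ext1 z
        simp [RangeGamma.toMatrix_add, Matrix.add_mul, Matrix.mul_add]
      map_smul' := fun r Λ => by
        ext1 z
        simp [RangeGamma.toMatrix_smul] }

theorem sandwichMap_apply (Λ : RangeGamma A B hA) (z : Circle) :
    sandwichMap A B hA Λ z = (transfer A B z)ᴴ * Λ.toMatrix * transfer A B z := rfl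

theorem one_add_sandwichMap_apply (Λ : RangeGamma A B hA) (z : Circle) :
    (1 + sandwichMap A B hA Λ) z = Q A B Λ.toMatrix z := rfl

theorem isHermitian_sandwichMap (Λ : RangeGamma A B hA) (z : Circle) :
    (sandwichMap A B hA Λ z).IsHermitian := by
  have := Λ.isHermitian.eq
  rw [Matrix.IsHermitian, sandwichMap_apply]
  simp [Matrix.conjTranspose_mul, this, Matrix.mul_assoc]

theorem isHermitian_Q (Λ : RangeGamma A B hA) (z : Circle) : (Q A B Λ.toMatrix z).IsHermitian :=
  Matrix.isHermitian_one.add (isHermitian_sandwichMap Λ z)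

theorem continuous_Q (Λ : RangeGamma A B hA) : Continuous (Q A B Λ.toMatrix) :=
  (1 + sandwichMap A B hA Λ).continuous

theorem mem_LHGamma_iff (Λ : RangeGamma A B hA) :
    Λ ∈ LHGamma A B hA ↔ ∀ z, (Q A B Λ.toMatrix z).PosDef :=
  ⟨fun h => h.2, fun h => ⟨Λ.isHermitian, h⟩⟩

theorem zero_mem_LHGamma : (0 : RangeGamma A B hA) ∈ LHGamma A B hA := by
  rw [mem_LHGamma_iff]
  intro z
  simpa [Q, RangeGamma.toMatrix_zero] using Matrix.PosDef.one

/-- Pairing of an element of `Range Γ` with `Γ Φ`. -/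
theorem re_trace_mul_Gamma (Λ : RangeGamma A B hA) (Φ : C(Circle, Herm m)) :
    (Λ.toMatrix * Gamma A B hA Φ).trace.re =
      circleMean fun z => ((Φ z : Matrix (Fin m) (Fin m) ℂ) * sandwichMap A B hA Λ z).trace.re := by
  have hG := continuous_transfer hA B
  have hΦ : Continuous fun z => (Φ z : Matrix (Fin m) (Fin m) ℂ) :=
    continuous_subtype_val.comp Φ.continuous
  have hc : Continuous fun z =>
      transfer A B z * (Φ z : Matrix (Fin m) (Fin m) ℂ) * (transfer A B z)ᴴ :=
    (hG.matrix_mul hΦ).matrix_mul hG.matrix_conjTranspose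
  have h1 : Gamma A B hA Φ = normCircleIntegral fun z =>
    transfer A B z * (Φ z : Matrix (Fin m) (Fin m) ℂ) * (transfer A B z)ᴴ := rfl
  rw [h1, mul_normCircleIntegral _ (circleInt_apply_of_continuous hc),
    re_trace_normCircleIntegral fun i => circleInt_apply_of_continuous
      (continuous_const.matrix_mul hc) i i]
  congr 1
  ext z
  rw [sandwichMap_apply, ← Matrix.mul_assoc, Matrix.trace_mul_comm, ← Matrix.mul_assoc,
    ← Matrix.mul_assoc, Matrix.trace_mul_comm]

/-- Membership in `Range Γ` is what counts: if `Λ = Γ Φ` and `G*ΛG = 0`, then `tr Λ² = Re tr ∫ Φ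
G*ΛG = 0`, so `Λ = 0`. -/
theorem sandwichMap_injective : Function.Injective (sandwichMap A B hA) := by
  rw [injective_iff_map_eq_zero]
  intro Λ hΛ
  obtain ⟨Φ, hΦ⟩ := Λ.exists_eq
  have h := re_trace_mul_Gamma Λ Φ
  rw [hΦ, hΛ] at h
  simp only [ContinuousMap.zero_apply, Matrix.mul_zero, Matrix.trace_zero, Complex.zero_re,
    circleMean_const] at h
  have hpsd : (Λ.toMatrix * Λ.toMatrix).PosSemidef := by
    have := Matrix.posSemidef_conjTranspose_mul_self Λ.toMatrix
    rwa [Λ.isHermitian.eq] at this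
  have htr : (Λ.toMatrix * Λ.toMatrix).trace = 0 :=
    Complex.ext h (Complex.le_def.1 hpsd.trace_nonneg).2.symm
  have h0 := hpsd.trace_eq_zero_iff.1 htr
  refine RangeGamma.eq_zero_of_toMatrix (Matrix.conjTranspose_mul_self_eq_zero.1 ?_)
  rwa [Λ.isHermitian.eq]

/-- Positivity of a jointly continuous form over the compact product of the circle and the unit
sphere persists under small changes of `Λ`. -/
theorem isOpen_LHGamma : IsOpen (LHGamma A B hA) := by
  rw [isOpen_iff_mem_nhds]
  intro Λ hΛ
  rw [mem_LHGamma_iff] at hΛ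
  have hcont : Continuous fun p : RangeGamma A B hA × (Circle × (Fin m → ℂ)) =>
      quadForm (Q A B p.1.toMatrix p.2.1) p.2.2 := by
    have hG : Continuous fun p : RangeGamma A B hA × (Circle × (Fin m → ℂ)) =>
        transfer A B p.2.1 := (continuous_transfer hA B).comp (continuous_fst.comp continuous_snd)
    have hQ : Continuous fun p : RangeGamma A B hA × (Circle × (Fin m → ℂ)) =>
        Q A B p.1.toMatrix p.2.1 :=
      continuous_const.add ((hG.matrix_conjTranspose.matrix_mul
        (continuous_toMatrix.comp continuous_fst)).matrix_mul hG)
    exact continuous_quadForm.comp (hQ.prodMk (continuous_snd.comp continuous_snd))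
  have hK : IsCompact ((Set.univ : Set Circle) ×ˢ unitVectors m) :=
    isCompact_univ.prod (isCompact_unitVectors m)
  have hev := hK.eventually_forall_of_forall_eventually (x₀ := Λ)
    (P := fun Λ' p => 0 < quadForm (Q A B Λ'.toMatrix p.1) p.2) fun p hp =>
      hcont.continuousAt.eventually_const_lt (quadForm_pos (hΛ p.1) hp.2)
  filter_upwards [hev] with Λ' hΛ'
  rw [mem_LHGamma_iff]
  exact fun z => posDef_of_quadForm_pos (isHermitian_Q Λ' z) fun v hv => hΛ' (z, v) ⟨trivial, hv⟩

theorem convex_LHGamma : Convex ℝ (LHGamma A B hA) := by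
  intro Λ hΛ Λ' hΛ' a b ha hb hab
  rw [mem_LHGamma_iff] at *
  intro z
  have h1 : Q A B (a • Λ + b • Λ').toMatrix z =
      (a : ℂ) • Q A B Λ.toMatrix z + (b : ℂ) • Q A B Λ'.toMatrix z := by
    have h2 : ((1 : ℝ) : ℂ) = (a : ℂ) + (b : ℂ) := by rw [← hab]; push_cast; rfl
    rw [RangeGamma.toMatrix_add, RangeGamma.toMatrix_smul, RangeGamma.toMatrix_smul]
    simp only [Q, Matrix.mul_add, Matrix.add_mul, smul_add, Matrix.mul_smul, Matrix.smul_mul,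
      Complex.coe_smul]
    have h3 : (1 : Matrix (Fin m) (Fin m) ℂ) = a • 1 + b • 1 := by
      rw [← add_smul, hab, one_smul]
    nth_rewrite 1 [h3]
    abel
  rw [h1]
  refine posDef_of_quadForm_pos ?_ fun v hv => ?_
  · rw [← h1]
    exact isHermitian_Q _ z
  · have e : ∀ (r : ℝ) (M : Matrix (Fin m) (Fin m) ℂ),
        quadForm ((r : ℂ) • M) v = r * quadForm M v := by
      intro r M
      simp [quadForm, Matrix.smul_mulVec]
    rw [quadForm_add, e, e]
    have p1 := quadForm_pos (hΛ z) hv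
    have p2 := quadForm_pos (hΛ' z) hv
    rcases ha.eq_or_lt with rfl | ha'
    · have : b = 1 := by linarith
      subst this
      linarith
    · have := mul_pos ha' p1
      have := mul_nonneg hb p2.le
      linarith

variable (A B hA) in
/-- The linear form `Λ ↦ tr Λ`. -/
noncomputable def traceForm : RangeGamma A B hA →L[ℝ] ℝ :=
  LinearMap.toContinuousLinearMap
    { toFun := fun Λ => Λ.toMatrix.trace.re
      map_add' := fun Λ₁ Λ₂ => by simp [RangeGamma.toMatrix_add]
      map_smul' := fun r Λ => by simp [RangeGamma.toMatrix_smul] }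

variable {Ψ : Circle → Matrix (Fin m) (Fin m) ℂ} (hΨ : IsSpectralDensity Ψ)

theorem isUnit_one_add_sandwichMap {Λ : RangeGamma A B hA} (hΛ : Λ ∈ LHGamma A B hA) :
    IsUnit (1 + sandwichMap A B hA Λ) :=
  isUnit_of_posDef ((mem_LHGamma_iff Λ).1 hΛ)

theorem continuous_Q_inv {Λ : RangeGamma A B hA} (hΛ : Λ ∈ LHGamma A B hA) :
    Continuous fun z => (Q A B Λ.toMatrix z)⁻¹ := by
  convert (Ring.inverse (1 + sandwichMap A B hA Λ)).continuous using 2 with z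
  exact (inverse_apply (isUnit_one_add_sandwichMap hΛ) z).symm

include hΨ in
theorem J_eq_circleMean {Λ : RangeGamma A B hA} (hΛ : Λ ∈ LHGamma A B hA) :
    J A B hA Ψ Λ = (circleMean fun z => ((Q A B Λ.toMatrix z)⁻¹ * Ψ z).trace.re) +
      Λ.toMatrix.trace.re := by
  rw [J, Complex.add_re, re_trace_normCircleIntegral fun i =>
    hΨ.circleInt_mul (continuous_Q_inv hΛ) i i]

theorem J_eq_inverseFunctional {Λ : RangeGamma A B hA} (hΛ : Λ ∈ LHGamma A B hA) :
    J A B hA Ψ Λ =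
      inverseFunctional (sandwichMap A B hA) (densityFunctional hΨ) (traceForm A B hA) Λ := by
  rw [J_eq_circleMean hΨ hΛ, inverseFunctional, densityFunctional_apply]
  simp only [inverse_apply (isUnit_one_add_sandwichMap hΛ)]
  rfl

/-- Derivatives depend only on the germ, so an identity on the open set `LHGamma` transfers them
all. -/
theorem J_eventuallyEq {Λ : RangeGamma A B hA} (hΛ : Λ ∈ LHGamma A B hA) :
    J A B hA Ψ =ᶠ[𝓝 Λ]
      inverseFunctional (sandwichMap A B hA) (densityFunctional hΨ) (traceForm A B hA) := by
  filter_upwards [isOpen_LHGamma.mem_nhds hΛ] with Λ' h using J_eq_inverseFunctional hΨ h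

include hΨ in
theorem contDiffAt_J {Λ : RangeGamma A B hA} (hΛ : Λ ∈ LHGamma A B hA) :
    ContDiffAt ℝ 3 (J A B hA Ψ) Λ :=
  (contDiffAt_inverseFunctional _ _ (isUnit_one_add_sandwichMap hΛ) 3).congr_of_eventuallyEq
    (J_eventuallyEq hΨ hΛ)

include hΨ in
-- With `i = Q⁻¹` and `d = G*δG`, the product `i d i d i = (d i)* i (d i)` is positive semidefinite.
-- Coercivity of `Ψ` reduces the claim to a positive mean of its trace. That trace is continuous and
-- vanishes only where `d` does, and `d` is not identically zero by injectivity.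
theorem hess_J_pos {Λ : RangeGamma A B hA} (hΛ : Λ ∈ LHGamma A B hA) {δ : RangeGamma A B hA}
    (hδ : δ ≠ 0) : 0 < fderiv ℝ (fderiv ℝ (J A B hA Ψ)) Λ δ δ := by
  have hu := isUnit_one_add_sandwichMap hΛ
  have hpos := (mem_LHGamma_iff Λ).1 hΛ
  rw [(J_eventuallyEq hΨ hΛ).fderiv.fderiv_eq, fderiv_fderiv_inverseFunctional_apply _ _ hu]
  refine mul_pos two_pos ?_
  set i := Ring.inverse (1 + sandwichMap A B hA Λ) with hi
  set d := sandwichMap A B hA δ with hd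
  have hiz : ∀ z, (i z).PosDef := fun z => by
    rw [hi, inverse_apply hu]
    exact (hpos z).inv
  have hdz : ∀ z, (d z)ᴴ = d z := fun z => isHermitian_sandwichMap δ z
  have hform : ∀ z, (i * d * i * d * i) z = (d z * i z)ᴴ * i z * (d z * i z) := fun z => by
    simp only [ContinuousMap.mul_apply, Matrix.conjTranspose_mul, hdz, (hiz z).isHermitian.eq,
      Matrix.mul_assoc]
  have hpsd : ∀ z, ((i * d * i * d * i) z).PosSemidef := fun z => by
    rw [hform]
    exact (hiz z).posSemidef.conjTranspose_mul_mul_same _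
  obtain ⟨c, hc, hΨc⟩ := hΨ.coercive
  have hd0 : d ≠ 0 := fun h => hδ (sandwichMap_injective (h.trans (map_zero _).symm))
  obtain ⟨z, hz⟩ : ∃ z, d z ≠ 0 := by
    by_contra! h
    exact hd0 (ContinuousMap.ext h)
  have hcont : Continuous fun z => ((i * d * i * d * i) z).trace.re :=
    Complex.continuous_re.comp (i * d * i * d * i).continuous.matrix_trace
  have hnn : ∀ z, 0 ≤ ((i * d * i * d * i) z).trace.re := fun z =>
    (Complex.le_def.1 (hpsd z).trace_nonneg).1
  have hzpos : 0 < ((i * d * i * d * i) z).trace.re := by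
    refine lt_of_le_of_ne (hnn z) fun h0 => hz ?_
    have htr : ((i * d * i * d * i) z).trace = 0 :=
      Complex.ext h0.symm (Complex.le_def.1 (hpsd z).trace_nonneg).2.symm
    have h1 := (hpsd z).trace_eq_zero_iff.1 htr
    rw [hform] at h1
    have h2 := posDef_conj_eq_zero (hiz z) h1
    obtain ⟨u, hu⟩ := (hiz z).isUnit
    rw [← hu] at h2
    exact (Units.mul_left_eq_zero u).1 h2
  have hmain : circleMean (fun z => c * ((i * d * i * d * i) z).trace.re) ≤
      densityFunctional hΨ (i * d * i * d * i) := by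
    rw [densityFunctional_apply]
    refine circleMean_mono (circleInt_of_continuous (continuous_const.mul hcont))
      (circleInt_re_trace fun k => hΨ.circleInt_mul (i * d * i * d * i).continuous k k) fun z => ?_
    rw [Matrix.trace_mul_comm _ (Ψ z)]
    exact mul_re_trace_le (hΨc z) (hpsd z)
  rw [circleMean_const_mul] at hmain
  exact (mul_pos hc (circleMean_pos hcont hnn hzpos)).trans_le hmain

/-- Identifies `sublevel` with the sublevel set through the starting point of the algorithm. -/
theorem J_zero : J A B hA Ψ 0 = (normCircleIntegral Ψ).trace.re := by
  simp [J, Q, RangeGamma.toMatrix_zero]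

end DualFunctional

/-! ### A positive definite solution of the moment constraint. -/

section Feasibility

variable {m n : ℕ}

open scoped Matrix.Norms.L2Operator MatrixOrder in
/-- A positive definite matrix `N` such that `B N B*` is the projection onto the range of `B`. -/
theorem exists_posDef_mul_eq (B : Matrix (Fin n) (Fin m) ℂ) :
    ∃ N : Matrix (Fin m) (Fin m) ℂ, N.PosDef ∧ B * N * Bᴴ * B = B := by
  set M : Matrix (Fin m) (Fin m) ℂ := Bᴴ * B with hM
  have hMh : IsSelfAdjoint M := Matrix.isHermitian_conjTranspose_mul_self B
  -- Inverse off the kernel of `B*B` and `1` on it: `f` stays positive even if `B` is not injective,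
  -- while `x f(x) x = x` still holds. Continuity on the spectrum is free because the spectrum is
  -- finite.
  let f : ℝ → ℝ := fun x => if x = 0 then 1 else x⁻¹
  have hfc : ∀ g : ℝ → ℝ, ContinuousOn g (spectrum ℝ M) := fun g =>
    Matrix.finite_real_spectrum.continuousOn g
  have hsp : ∀ x ∈ spectrum ℝ M, 0 ≤ x := by
    intro x hx
    exact spectrum_nonneg_of_nonneg
      (Matrix.nonneg_iff_posSemidef.2 (Matrix.posSemidef_conjTranspose_mul_self B)) hx
  have hfpos : ∀ x ∈ spectrum ℝ M, 0 < f x := by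
    intro x hx
    have h0 := hsp x hx
    simp only [f]
    split_ifs with h
    · exact one_pos
    · exact inv_pos.2 (lt_of_le_of_ne h0 (Ne.symm h))
  set N := cfc f M with hN
  have hNpos : N.PosDef := by
    rw [← Matrix.isStrictlyPositive_iff_posDef]
    have hu : IsUnit N := (isUnit_cfc_iff f M (hfc f) hMh).2 fun x hx => (hfpos x hx).ne'
    exact hu.isStrictlyPositive (cfc_nonneg fun x hx => (hfpos x hx).le)
  have hMNM : M * N * M = M := by
    have h1 : M = cfc (fun x : ℝ => x) M := (cfc_id' ℝ M).symm
    have h2 : M * N * M = cfc (fun x : ℝ => x * f x * x) M := by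
      rw [cfc_mul (fun x : ℝ => x * f x) (fun x => x) M (hfc _) (hfc _),
        cfc_mul (fun x : ℝ => x) f M (hfc _) (hfc _), ← h1]
    rw [h2]
    conv_rhs => rw [h1]
    refine cfc_congr fun x _ => ?_
    simp only [f]
    split_ifs with h
    · simp [h]
    · field_simp
  refine ⟨N, hNpos, ?_⟩
  have hNh : Nᴴ = N := hNpos.isHermitian.eq
  have hzero : (B * N * Bᴴ * B - B)ᴴ * (B * N * Bᴴ * B - B) = 0 := by
    have e1 : (B * N * Bᴴ * B - B) = B * (N * M - 1) := by
      rw [hM, Matrix.mul_sub, Matrix.mul_one]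
      simp only [Matrix.mul_assoc]
    have hMh' : Mᴴ = M := hMh
    rw [e1, Matrix.conjTranspose_mul, Matrix.conjTranspose_sub, Matrix.conjTranspose_mul, hNh,
      hMh', Matrix.conjTranspose_one, Matrix.mul_assoc, ← Matrix.mul_assoc Bᴴ, ← hM,
      Matrix.mul_sub M, ← Matrix.mul_assoc M, hMNM, Matrix.mul_one, sub_self, Matrix.mul_zero]
  exact sub_eq_zero.1 (Matrix.conjTranspose_mul_self_eq_zero.1 hzero)

theorem continuous_circle_coe : Continuous fun z : Circle => (z : ℂ) :=
  continuous_subtype_val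

theorem re_star_dotProduct_self (v : Fin n → ℂ) :
    0 ≤ (star v ⬝ᵥ v).re ∧ ((star v ⬝ᵥ v).re = 0 → v = 0) := by
  rw [star_dotProduct_self_eq, Complex.ofReal_re]
  refine ⟨Finset.sum_nonneg fun i _ => sq_nonneg _, fun h0 => funext fun i => ?_⟩
  have := (Finset.sum_eq_zero_iff_of_nonneg fun i _ => sq_nonneg ‖v i‖).1 h0 i (Finset.mem_univ i)
  simpa using this

/-- On the circle `1 - zA*` equals `z (zI - A)*`, since `z` has modulus one. -/
theorem det_one_sub_smul_conjTranspose_ne_zero {A : Matrix (Fin n) (Fin n) ℂ} (hA : IsStable A)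
    (z : Circle) : (1 - (z : ℂ) • Aᴴ).det ≠ 0 := by
  have h := det_ne_zero_of_isStable hA z
  have h1 : (1 - (z : ℂ) • Aᴴ) = (z : ℂ) • ((z : ℂ) • (1 : Matrix (Fin n) (Fin n) ℂ) - A)ᴴ := by
    rw [Matrix.conjTranspose_sub, Matrix.conjTranspose_smul, Matrix.conjTranspose_one, smul_sub,
      smul_smul, Complex.star_def, Complex.mul_conj', Circle.norm_coe]
    simp
  rw [h1, Matrix.det_smul, Matrix.det_conjTranspose]
  exact mul_ne_zero (pow_ne_zero _ (Circle.coe_ne_zero z)) (star_ne_zero.2 h)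

/-- If `1 - A' A'* = B N B*` with `N > 0`, and `A'` differs from the stable matrix `A` by
state feedback, then `1 - w A'*` is invertible on the closed unit disc. -/
theorem det_one_sub_smul_feedback_ne_zero {A A' : Matrix (Fin n) (Fin n) ℂ}
    {B : Matrix (Fin n) (Fin m) ℂ} {N : Matrix (Fin m) (Fin m) ℂ} {F : Matrix (Fin m) (Fin n) ℂ}
    (hA : IsStable A) (hN : N.PosDef) (hfb : A' = A - B * F)
    (heq : 1 - A' * A'ᴴ = B * N * Bᴴ) {w : ℂ} (hw : ‖w‖ ≤ 1) : (1 - w • A'ᴴ).det ≠ 0 := by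
  intro hdet
  obtain ⟨v, hv0, hv⟩ := Matrix.exists_mulVec_eq_zero_iff.2 hdet
  have hv1 : v = w • (A'ᴴ *ᵥ v) := by
    rw [Matrix.sub_mulVec, Matrix.one_mulVec, Matrix.smul_mulVec, sub_eq_zero] at hv
    exact hv
  set u := A'ᴴ *ᵥ v with hu
  have hnv : star v ⬝ᵥ v = ((‖w‖ ^ 2 : ℝ) : ℂ) * (star u ⬝ᵥ u) := by
    conv_lhs => rw [hv1]
    rw [star_smul, smul_dotProduct, dotProduct_smul, smul_eq_mul, smul_eq_mul, ← mul_assoc,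
      Complex.star_def, Complex.conj_mul']
    push_cast
    rfl
  -- With `v = w u`, the left side is at most `0` as `|w| ≤ 1`, while `N > 0` makes the right side
  -- positive unless `B*v = 0`. Hence `B*v = 0` and `|w| = 1`. The feedback term then vanishes on
  -- `v`, which contradicts the stability of `A`.
  have hquad : star v ⬝ᵥ v - star u ⬝ᵥ u = star (Bᴴ *ᵥ v) ⬝ᵥ N *ᵥ (Bᴴ *ᵥ v) := by
    have h1 : star v ⬝ᵥ (1 - A' * A'ᴴ) *ᵥ v = star v ⬝ᵥ v - star u ⬝ᵥ u := by
      rw [Matrix.sub_mulVec, Matrix.one_mulVec, dotProduct_sub, hu, Matrix.star_mulVec,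
        Matrix.conjTranspose_conjTranspose, ← Matrix.dotProduct_mulVec, Matrix.mulVec_mulVec]
    rw [← h1, heq, Matrix.star_mulVec, Matrix.conjTranspose_conjTranspose,
      ← Matrix.dotProduct_mulVec, Matrix.mulVec_mulVec, Matrix.mulVec_mulVec, Matrix.mul_assoc]
  have hnvr : (star v ⬝ᵥ v).re = ‖w‖ ^ 2 * (star u ⬝ᵥ u).re := by
    rw [hnv, Complex.re_ofReal_mul]
  have hw2 : ‖w‖ ^ 2 ≤ 1 := pow_le_one₀ (norm_nonneg w) hw
  have hu0 := (re_star_dotProduct_self u).1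
  have hle : (star v ⬝ᵥ v).re ≤ (star u ⬝ᵥ u).re := by
    rw [hnvr]
    exact mul_le_of_le_one_left hu0 hw2
  have hB : Bᴴ *ᵥ v = 0 := by
    by_contra hB
    have h := (Complex.lt_def.1 (hN.dotProduct_mulVec_pos hB)).1
    rw [← hquad] at h
    simp only [Complex.zero_re, Complex.sub_re] at h
    linarith
  have heqn : (star v ⬝ᵥ v).re = (star u ⬝ᵥ u).re := by
    rw [hB] at hquad
    simp only [Matrix.mulVec_zero, dotProduct_zero] at hquad
    rw [sub_eq_zero.1 hquad]
  have hvpos : 0 < (star v ⬝ᵥ v).re :=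
    lt_of_le_of_ne (re_star_dotProduct_self v).1
      fun h => hv0 ((re_star_dotProduct_self v).2 h.symm)
  have hw1 : ‖w‖ = 1 := by
    rw [← heqn] at hnvr
    have : ‖w‖ ^ 2 = 1 := by
      have h2 : (1 - ‖w‖ ^ 2) * (star v ⬝ᵥ v).re = 0 := by linarith
      rcases mul_eq_zero.1 h2 with h | h
      · linarith
      · exact absurd h hvpos.ne'
    exact (pow_eq_one_iff_of_nonneg (norm_nonneg w) two_ne_zero).1 this
  have huA : u = Aᴴ *ᵥ v := by
    rw [hu, hfb, Matrix.conjTranspose_sub, Matrix.conjTranspose_mul, Matrix.sub_mulVec,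
      ← Matrix.mulVec_mulVec, hB, Matrix.mulVec_zero, sub_zero]
  let z : Circle := ⟨w, mem_sphere_zero_iff_norm.2 hw1⟩
  refine det_one_sub_smul_conjTranspose_ne_zero hA z (Matrix.exists_mulVec_eq_zero_iff.1
    ⟨v, hv0, ?_⟩)
  rw [Matrix.sub_mulVec, Matrix.one_mulVec, Matrix.smul_mulVec, ← huA, sub_eq_zero]
  exact hv1

/-- The mean value property on the unit disc: by Cramer's rule the entries of the inverse are
holomorphic near the closed disc, and at `w = 0` the inverse is `1`. -/
theorem circleMean_re_trace_mul_inv {A' : Matrix (Fin n) (Fin n) ℂ}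
    (hdet : ∀ w : ℂ, ‖w‖ ≤ 1 → (1 - w • A'ᴴ).det ≠ 0) (X : Matrix (Fin n) (Fin n) ℂ) :
    circleMean (fun z => (X * (1 - (z : ℂ) • A'ᴴ)⁻¹).trace.re) = X.trace.re := by
  let f : ℂ → ℂ := fun w => (X * (1 - w • A'ᴴ)⁻¹).trace
  have hentry : ∀ i j, Differentiable ℂ fun w : ℂ => (1 - w • A'ᴴ) i j := by
    intro i j
    simp only [Matrix.sub_apply, Matrix.smul_apply, smul_eq_mul]
    fun_prop
  have hdetd : ∀ M : ℂ → Matrix (Fin n) (Fin n) ℂ, (∀ i j, Differentiable ℂ fun w => M w i j) →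
      Differentiable ℂ fun w => (M w).det := by
    intro M hM
    simp only [Matrix.det_apply']
    fun_prop
  have hadj : ∀ i j, Differentiable ℂ fun w : ℂ => (1 - w • A'ᴴ).adjugate i j := by
    intro i j
    simp only [Matrix.adjugate_apply]
    refine hdetd _ fun k l => ?_
    by_cases hk : k = j
    · subst hk
      simp
    · simp only [Matrix.updateRow_ne hk]
      exact hentry k l
  have hfd : ∀ w : ℂ, ‖w‖ ≤ 1 → DifferentiableAt ℂ f w := by
    intro w hw
    have h1 : ∀ i j, DifferentiableAt ℂ (fun w : ℂ => (1 - w • A'ᴴ)⁻¹ i j) w := by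
      intro i j
      simp only [Matrix.inv_def, Ring.inverse_eq_inv', Matrix.smul_apply, smul_eq_mul]
      exact ((hdetd _ hentry).differentiableAt.inv (hdet w hw)).mul (hadj i j).differentiableAt
    simp only [f, Matrix.trace, Matrix.diag, Matrix.mul_apply]
    exact DifferentiableAt.fun_sum fun i _ => DifferentiableAt.fun_sum fun j _ =>
      (differentiableAt_const _).mul (h1 j i)
  have hdcc : DiffContOnCl ℂ f (Metric.ball 0 |1|) := by
    refine DifferentiableOn.diffContOnCl fun w hw => (hfd w ?_).differentiableWithinAt
    rw [abs_one, closure_ball _ one_ne_zero] at hw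
    simpa using hw
  have havg := hdcc.circleAverage
  have hf0 : f 0 = X.trace := by simp [f]
  rw [hf0, Real.circleAverage_def] at havg
  have hmap : ∀ θ : ℝ, circleMap 0 1 θ = (Circle.exp θ : ℂ) := fun θ => by
    simp [circleMap, Circle.coe_exp]
  simp only [hmap] at havg
  have hcont : Continuous fun z : Circle => f z := by
    refine continuous_iff_continuousAt.2 fun z => ?_
    exact ContinuousAt.comp (f := fun z : Circle => (z : ℂ)) (g := f)
      (hfd z (Circle.norm_coe z).le).continuousAt continuous_circle_coe.continuousAt
  rw [← havg, Complex.smul_re, smul_eq_mul, circleMean]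
  congr 1
  exact intervalIntegral.intervalIntegral_re (circleInt_of_continuous hcont)

/-- Feasibility provides a continuous, pointwise positive definite `Φ₀` with `∫ G Φ₀ G* = I`. -/
theorem exists_posDef_re_trace_eq {A : Matrix (Fin n) (Fin n) ℂ} {B : Matrix (Fin n) (Fin m) ℂ}
    (hA : IsStable A) (hfeas : IsFeasible A B) :
    ∃ Φ₀ : Circle → Matrix (Fin m) (Fin m) ℂ, Continuous Φ₀ ∧ (∀ z, (Φ₀ z).PosDef) ∧
      ∀ Λ : Matrix (Fin n) (Fin n) ℂ, Λ.IsHermitian → Λ.trace.re = circleMean fun z =>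
        (Φ₀ z * ((transfer A B z)ᴴ * Λ * transfer A B z)).trace.re := by
  obtain ⟨H, hH⟩ := hfeas
  obtain ⟨N, hN, hBN⟩ := exists_posDef_mul_eq B
  have hNh : Nᴴ = N := hN.isHermitian.eq
  set P := B * N * Bᴴ with hP
  have hPh : Pᴴ = P := by
    simp [hP, Matrix.conjTranspose_mul, hNh, Matrix.mul_assoc]
  have hPP : P * P = P := by
    conv_lhs => rw [hP, ← hP, ← Matrix.mul_assoc, ← Matrix.mul_assoc, hBN]
  have hBP : Bᴴ * P = Bᴴ := by
    have := congrArg Matrix.conjTranspose hBN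
    rwa [Matrix.conjTranspose_mul, hPh] at this
  -- This feedback removes the part of `A` with values in the range of `B`, as `A - BF = (1 - P)A`.
  set F := N * Bᴴ * A with hF
  set A' := A - B * F with hA'
  have hA'P : A' = (1 - P) * A := by
    rw [hA', hF, Matrix.sub_mul, Matrix.one_mul, hP]
    simp only [Matrix.mul_assoc]
  -- Feasibility enters here: compressing `AA* = 1 - BH - H*B*` by `1 - P` kills both terms
  -- containing `B` and leaves `A'A'* = 1 - P`.
  have heq : 1 - A' * A'ᴴ = P := by
    have h1 : A * Aᴴ = 1 - (B * H + Hᴴ * Bᴴ) := by rw [← hH]; abel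
    have h2 : (1 - P) * B = 0 := by rw [Matrix.sub_mul, Matrix.one_mul, hBN, sub_self]
    have h3 : Bᴴ * (1 - P) = 0 := by rw [Matrix.mul_sub, Matrix.mul_one, hBP, sub_self]
    have h4 : (1 - P) * (1 - P) = 1 - P := by
      rw [Matrix.mul_sub, Matrix.mul_one, Matrix.sub_mul, Matrix.one_mul, hPP, sub_self, sub_zero]
    have h5 : A' * A'ᴴ = (1 - P) * (A * Aᴴ) * (1 - P) := by
      rw [hA'P, Matrix.conjTranspose_mul, Matrix.conjTranspose_sub, hPh, Matrix.conjTranspose_one]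
      simp only [Matrix.mul_assoc]
    have h6 : (1 - P) * (A * Aᴴ) = 1 - P - (1 - P) * Hᴴ * Bᴴ := by
      rw [h1, Matrix.mul_sub (1 - P), Matrix.mul_one, Matrix.mul_add, ← Matrix.mul_assoc, h2,
        Matrix.zero_mul, zero_add, Matrix.mul_assoc]
    rw [h5, h6, Matrix.sub_mul, h4, Matrix.mul_assoc _ Bᴴ, h3, Matrix.mul_zero, sub_zero,
      sub_sub_cancel]
  have hdet : ∀ w : ℂ, ‖w‖ ≤ 1 → (1 - w • A'ᴴ).det ≠ 0 := fun w hw =>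
    det_one_sub_smul_feedback_ne_zero hA hN hA' heq hw
  let D : Circle → Matrix (Fin n) (Fin n) ℂ := fun z => 1 - (z : ℂ) • A'ᴴ
  have hDu : ∀ z, IsUnit (D z).det := fun z => isUnit_iff_ne_zero.2 (hdet z (Circle.norm_coe z).le)
  let Z : Circle → Matrix (Fin n) (Fin n) ℂ := fun z => (D z)⁻¹
  have hDc : Continuous D :=
    continuous_const.sub (continuous_circle_coe.smul continuous_const)
  have hZc : Continuous Z := by
    simp only [Z, Matrix.inv_def, Ring.inverse_eq_inv']
    exact (hDc.matrix_det.inv₀ fun z => (hDu z).ne_zero).smul hDc.matrix_adjugate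
  have hDZ : ∀ z, D z * Z z = 1 := fun z => Matrix.mul_nonsing_inv _ (hDu z)
  have hZDh : ∀ z, (Z z)ᴴ * (D z)ᴴ = 1 := fun z => by
    rw [← Matrix.conjTranspose_mul, hDZ, Matrix.conjTranspose_one]
  have hzz : ∀ z : Circle, star (z : ℂ) * (z : ℂ) = 1 := fun z => by
    rw [Complex.star_def, Complex.conj_mul', Circle.norm_coe]
    simp
  -- This splits `(zI - A')⁻¹ P (zI - A')⁻*` into an analytic part, its adjoint and a constant; by
  -- the mean value property its mean is `1 + 1 - 1`.
  have hZPZ : ∀ z, (Z z)ᴴ * P * Z z = Z z + (Z z)ᴴ - 1 := by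
    intro z
    have h1 : P = D z + (D z)ᴴ - (D z)ᴴ * D z := by
      have h2 : (D z)ᴴ = 1 - star (z : ℂ) • A' := by
        simp [D, Matrix.conjTranspose_sub, Matrix.conjTranspose_smul]
      rw [h2, ← heq]
      simp only [D, Matrix.sub_mul, Matrix.mul_sub, Matrix.one_mul, Matrix.mul_one,
        Matrix.smul_mul, Matrix.mul_smul, smul_sub, smul_smul]
      rw [mul_comm, hzz, one_smul]
      abel
    rw [h1, Matrix.mul_sub, Matrix.mul_add, hZDh, ← Matrix.mul_assoc, hZDh, Matrix.one_mul,
      Matrix.sub_mul, Matrix.add_mul, Matrix.one_mul, Matrix.mul_assoc, hDZ, Matrix.mul_one]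
    abel
  let R : Circle → Matrix (Fin n) (Fin n) ℂ := fun z => star (z : ℂ) • (Z z)ᴴ
  have hRc : Continuous R :=
    (continuous_star.comp continuous_circle_coe).smul hZc.matrix_conjTranspose
  have hR : ∀ z : Circle, ((z : ℂ) • (1 : Matrix (Fin n) (Fin n) ℂ) - A') * R z = 1 := by
    intro z
    have h1 : ((z : ℂ) • (1 : Matrix (Fin n) (Fin n) ℂ) - A') = (z : ℂ) • (D z)ᴴ := by
      simp only [D, Matrix.conjTranspose_sub, Matrix.conjTranspose_smul, smul_sub, smul_smul,
        Matrix.conjTranspose_one, Matrix.conjTranspose_conjTranspose]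
      rw [mul_comm, hzz, one_smul]
    have h2 : (D z)ᴴ * (Z z)ᴴ = 1 := mul_eq_one_comm.1 (hZDh z)
    simp only [R]
    rw [h1, Matrix.smul_mul, Matrix.mul_smul, smul_smul, h2, mul_comm, hzz, one_smul]
  have hRPR : ∀ z, R z * P * (R z)ᴴ = (Z z)ᴴ * P * Z z := by
    intro z
    simp only [R, Matrix.conjTranspose_smul, Matrix.conjTranspose_conjTranspose, star_star,
      Matrix.smul_mul, Matrix.mul_smul, smul_smul]
    rw [mul_comm, hzz, one_smul]
  -- The feedback factor, with inverse `1 + FG`: it turns `G` into `(zI - A')⁻¹B`. Hence `Φ₀ = W N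
  -- W*` satisfies `G Φ₀ G* = (zI - A')⁻¹ P (zI - A')⁻*`.
  let W : Circle → Matrix (Fin m) (Fin m) ℂ := fun z => 1 - F * (R z * B)
  have hWc : Continuous W :=
    continuous_const.sub (continuous_const.matrix_mul (hRc.matrix_mul continuous_const))
  have hGW : ∀ z, transfer A B z * W z = R z * B := by
    intro z
    have hu : IsUnit ((z : ℂ) • (1 : Matrix (Fin n) (Fin n) ℂ) - A).det :=
      isUnit_iff_ne_zero.2 (det_ne_zero_of_isStable hA z)
    have h1 : B * W z = ((z : ℂ) • (1 : Matrix (Fin n) (Fin n) ℂ) - A) * (R z * B) := by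
      have h2 : ((z : ℂ) • (1 : Matrix (Fin n) (Fin n) ℂ) - A) =
          ((z : ℂ) • (1 : Matrix (Fin n) (Fin n) ℂ) - A') - B * F := by
        rw [hA']
        abel
      rw [h2, Matrix.sub_mul _ (B * F), ← Matrix.mul_assoc _ (R z) B, hR, Matrix.one_mul]
      simp only [W, Matrix.mul_sub, Matrix.mul_one, Matrix.mul_assoc]
    rw [transfer, Matrix.mul_assoc, h1, Matrix.nonsing_inv_mul_cancel_left _ _ hu]
  have hWu : ∀ z, IsUnit (W z) := by
    intro z
    have h1 : (1 + F * transfer A B z) * W z = 1 := by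
      rw [Matrix.add_mul, Matrix.one_mul, Matrix.mul_assoc, hGW]
      simp [W]
    exact IsUnit.of_mul_eq_one_right _ h1
  refine ⟨fun z => W z * N * (W z)ᴴ,
    (hWc.matrix_mul continuous_const).matrix_mul hWc.matrix_conjTranspose,
    fun z => hN.mul_mul_conjTranspose_same (Matrix.vecMul_injective_of_isUnit (hWu z)), ?_⟩
  intro Λ hΛ
  have hpt : ∀ z, (W z * N * (W z)ᴴ * ((transfer A B z)ᴴ * Λ * transfer A B z)).trace.re =
      2 * (Λ * Z z).trace.re - Λ.trace.re := by
    intro z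
    have h1 : (W z * N * (W z)ᴴ * ((transfer A B z)ᴴ * Λ * transfer A B z)).trace =
        (Λ * ((Z z)ᴴ * P * Z z)).trace := by
      have h2 : (Z z)ᴴ * P * Z z =
          (transfer A B z * W z) * N * (transfer A B z * W z)ᴴ := by
        rw [← hRPR, hGW, hP, Matrix.conjTranspose_mul]
        simp only [Matrix.mul_assoc]
      rw [h2, Matrix.conjTranspose_mul, Matrix.trace_mul_comm]
      rw [Matrix.trace_mul_comm Λ]
      rw [Matrix.mul_assoc _ (transfer A B z), Matrix.mul_assoc _ Λ, Matrix.trace_mul_comm _ (Λ * _)]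
      rw [Matrix.trace_mul_comm _ Λ]
      simp only [Matrix.mul_assoc]
    have h3 : (Λ * (Z z)ᴴ).trace.re = (Λ * Z z).trace.re := by
      have h4 : (Λ * (Z z)ᴴ) = (Z z * Λ)ᴴ := by
        rw [Matrix.conjTranspose_mul, hΛ.eq]
      rw [h4, Matrix.trace_conjTranspose, Matrix.trace_mul_comm]
      simp
    rw [h1, hZPZ, Matrix.mul_sub, Matrix.mul_add, Matrix.mul_one, Matrix.trace_sub,
      Matrix.trace_add, Complex.sub_re, Complex.add_re, h3]
    ring
  simp only [hpt]
  have hc : Continuous fun z => 2 * (Λ * Z z).trace.re :=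
    continuous_const.mul (Complex.continuous_re.comp (continuous_const.matrix_mul hZc).matrix_trace)
  rw [circleMean_sub (circleInt_of_continuous hc) (circleInt_of_continuous continuous_const),
    circleMean_const_mul, circleMean_const]
  have := circleMean_re_trace_mul_inv hdet Λ
  simp only [Z, D]
  rw [this]
  ring

end Feasibility

/-! ### Compactness of the sublevel set. -/

section Compactness

variable {m n : ℕ} {A : Matrix (Fin n) (Fin n) ℂ} {B : Matrix (Fin n) (Fin m) ℂ} {hA : IsStable A}

theorem continuous_re_trace {F : Circle → Matrix (Fin m) (Fin m) ℂ} (hF : Continuous F) :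
    Continuous fun z => (F z).trace.re :=
  Complex.continuous_re.comp hF.matrix_trace

/-- The functional dominates the means of `tr Q` and `tr Q⁻¹`. -/
theorem exists_le_J (hfeas : IsFeasible A B) {Ψ : Circle → Matrix (Fin m) (Fin m) ℂ}
    (hΨ : IsSpectralDensity Ψ) :
    ∃ c C : ℝ, 0 < c ∧ ∀ Λ ∈ LHGamma A B hA,
      c * circleMean (fun z => ((Q A B Λ.toMatrix z)⁻¹).trace.re) +
        c * circleMean (fun z => (Q A B Λ.toMatrix z).trace.re) ≤ J A B hA Ψ Λ + C := by
  obtain ⟨Φ₀, hΦc, hΦpos, hΦ⟩ := exists_posDef_re_trace_eq hA hfeas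
  obtain ⟨c₀, hc₀, hΦ₀⟩ := exists_pos_le_of_posDef hΦc hΦpos
  obtain ⟨c₁, hc₁, hΨ₁⟩ := hΨ.coercive
  have hmean : ∀ {d e : ℝ} (f : Circle → ℝ), d ≤ e → Continuous f → (∀ z, 0 ≤ f z) →
      d * circleMean f ≤ e * circleMean f := by
    intro d e f hde hf h0
    refine mul_le_mul_of_nonneg_right hde ?_
    have := circleMean_mono (circleInt_of_continuous continuous_const)
      (circleInt_of_continuous hf) h0
    rwa [circleMean_const] at this
  -- The additive constant is the price of replacing `G*ΛG` by `Q - 1` in `tr Λ = Re tr ∫ Φ₀G*ΛG`;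
  -- the factor is the smaller coercivity constant of `Φ₀` and `Ψ`.
  refine ⟨min c₀ c₁, circleMean fun z => (Φ₀ z).trace.re, lt_min hc₀ hc₁, fun Λ hΛ => ?_⟩
  have hpos := (mem_LHGamma_iff Λ).1 hΛ
  have hQc := continuous_Q Λ
  have hQi := continuous_Q_inv hΛ
  have h1 : c₁ * circleMean (fun z => ((Q A B Λ.toMatrix z)⁻¹).trace.re) ≤
      circleMean fun z => ((Q A B Λ.toMatrix z)⁻¹ * Ψ z).trace.re := by
    rw [← circleMean_const_mul]
    refine circleMean_mono (circleInt_of_continuous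
      (continuous_const.mul (continuous_re_trace hQi)))
      (circleInt_re_trace fun i => hΨ.circleInt_mul hQi i i) fun z => ?_
    rw [Matrix.trace_mul_comm _ (Ψ z)]
    exact mul_re_trace_le (hΨ₁ z) (hpos z).inv.posSemidef
  have h2 : c₀ * circleMean (fun z => (Q A B Λ.toMatrix z).trace.re) ≤
      Λ.toMatrix.trace.re + circleMean fun z => (Φ₀ z).trace.re := by
    have hG := continuous_transfer hA B
    have hsw : Continuous fun z => (transfer A B z)ᴴ * Λ.toMatrix * transfer A B z :=
      (hG.matrix_conjTranspose.matrix_mul continuous_const).matrix_mul hG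
    rw [← circleMean_const_mul, hΦ _ Λ.isHermitian, ← circleMean_add
      (circleInt_of_continuous (continuous_re_trace (hΦc.matrix_mul hsw)))
      (circleInt_of_continuous (continuous_re_trace hΦc))]
    refine circleMean_mono (circleInt_of_continuous
      (continuous_const.mul (continuous_re_trace hQc))) (circleInt_of_continuous
      ((continuous_re_trace (hΦc.matrix_mul hsw)).add (continuous_re_trace hΦc))) fun z => ?_
    have h3 := mul_re_trace_le (hΦ₀ z) (hpos z).posSemidef
    rw [Q, Matrix.mul_add, Matrix.mul_one, Matrix.trace_add (Φ₀ z), Complex.add_re] at h3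
    rw [Q]
    linarith
  have h4 := hmean (d := min c₀ c₁) (e := c₁) _ (min_le_right _ _) (continuous_re_trace hQi)
    fun z => (Complex.le_def.1 (hpos z).inv.posSemidef.trace_nonneg).1
  have h5 := hmean (d := min c₀ c₁) (e := c₀) _ (min_le_left _ _) (continuous_re_trace hQc)
    fun z => (Complex.le_def.1 (hpos z).posSemidef.trace_nonneg).1
  rw [J_eq_circleMean hΨ hΛ]
  linarith

open scoped Matrix.Norms.L2Operator

/-- An injective linear map from a finite-dimensional space into the continuous functions on the
circle is bounded below for the `L¹` norm. -/
theorem exists_pos_mul_norm_le_circleMean {E F : Type*} [NormedAddCommGroup E] [NormedSpace ℝ E]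
    [FiniteDimensional ℝ E] [NormedAddCommGroup F] [NormedSpace ℝ F] (T : E →L[ℝ] C(Circle, F))
    (hT : Function.Injective T) :
    ∃ c : ℝ, 0 < c ∧ ∀ x, c * ‖x‖ ≤ circleMean fun z => ‖T x z‖ := by
  have hcont : Continuous fun x => circleMean fun z => ‖T x z‖ := by
    refine continuous_const.mul
      (intervalIntegral.continuous_parametric_intervalIntegral_of_continuous' ?_ _ _)
    have h1 : Continuous fun p : E × ℝ => (T p.1, Circle.exp p.2) :=
      (T.continuous.comp continuous_fst).prodMk (Circle.exp.continuous.comp continuous_snd)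
    have h2 : Continuous fun p : C(Circle, F) × Circle => p.1 p.2 := continuous_eval
    exact (h2.comp h1).norm
  have hpos : ∀ x, x ≠ 0 → 0 < circleMean fun z => ‖T x z‖ := by
    intro x hx
    have hTx : T x ≠ 0 := fun h => hx (hT (h.trans (map_zero T).symm))
    obtain ⟨z, hz⟩ : ∃ z, T x z ≠ 0 := by
      by_contra! h
      exact hTx (ContinuousMap.ext h)
    exact circleMean_pos (T x).continuous.norm (fun _ => norm_nonneg _) (norm_pos_iff.2 hz)
  have hunit : ∃ c : ℝ, 0 < c ∧ ∀ x ∈ Metric.sphere (0 : E) 1, c ≤ circleMean fun z => ‖T x z‖ := by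
    rcases (Metric.sphere (0 : E) 1).eq_empty_or_nonempty with h | h
    · exact ⟨1, one_pos, fun x hx => absurd hx (by simp [h])⟩
    · have := FiniteDimensional.proper ℝ E
      obtain ⟨x, hx, hmin⟩ := (isCompact_sphere (0 : E) 1).exists_isMinOn h hcont.continuousOn
      exact ⟨_, hpos x (by rintro rfl; simp at hx), fun y hy => hmin hy⟩
  obtain ⟨c, hc, hcS⟩ := hunit
  refine ⟨c, hc, fun x => ?_⟩
  rcases eq_or_ne x 0 with rfl | hx
  · simp [circleMean_const]
  have hn : 0 < ‖x‖ := norm_pos_iff.2 hx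
  have h := hcS (‖x‖⁻¹ • x) (by simp [norm_smul, hn.ne'])
  have h2 : circleMean (fun z => ‖T (‖x‖⁻¹ • x) z‖) =
      ‖x‖⁻¹ * circleMean fun z => ‖T x z‖ := by
    rw [← circleMean_const_mul]
    simp [norm_smul]
  rw [h2, le_inv_mul_iff₀ hn] at h
  linarith

/-- The resolvent identity. The resolvent itself is `transfer A 1`, bounded on the circle by
continuity. -/
theorem exists_norm_transfer_sub_le (hA : IsStable A) (B : Matrix (Fin n) (Fin m) ℂ) :
    ∃ K : ℝ, 0 ≤ K ∧ ∀ z w : Circle,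
      ‖transfer A B z - transfer A B w‖ ≤ K * ‖(z : ℂ) - (w : ℂ)‖ := by
  have hc := continuous_transfer hA (1 : Matrix (Fin n) (Fin n) ℂ)
  obtain ⟨M, hM⟩ := isCompact_univ.exists_bound_of_continuousOn hc.continuousOn
  have hM' : ∀ z, ‖transfer A (1 : Matrix (Fin n) (Fin n) ℂ) z‖ ≤ |M| := fun z =>
    (hM z trivial).trans (le_abs_self M)
  refine ⟨|M| * |M| * ‖B‖, by positivity, fun z w => ?_⟩
  have hid : transfer A B z - transfer A B w =
      (w - z : ℂ) • (transfer A (1 : Matrix (Fin n) (Fin n) ℂ) z *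
        transfer A (1 : Matrix (Fin n) (Fin n) ℂ) w * B) := by
    have hz : IsUnit ((z : ℂ) • (1 : Matrix (Fin n) (Fin n) ℂ) - A).det :=
      isUnit_iff_ne_zero.2 (det_ne_zero_of_isStable hA z)
    have hw : IsUnit ((w : ℂ) • (1 : Matrix (Fin n) (Fin n) ℂ) - A).det :=
      isUnit_iff_ne_zero.2 (det_ne_zero_of_isStable hA w)
    simp only [transfer, Matrix.mul_one]
    set X := (z : ℂ) • (1 : Matrix (Fin n) (Fin n) ℂ) - A
    set Y := (w : ℂ) • (1 : Matrix (Fin n) (Fin n) ℂ) - A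
    have h1 : X⁻¹ - Y⁻¹ = X⁻¹ * (Y - X) * Y⁻¹ := by
      rw [Matrix.mul_sub, Matrix.nonsing_inv_mul _ hz, Matrix.sub_mul, Matrix.one_mul,
        Matrix.mul_nonsing_inv_cancel_right _ _ hw]
    have h2 : Y - X = (w - z : ℂ) • 1 := by
      simp only [X, Y, sub_smul]
      abel
    rw [← Matrix.sub_mul, h1, h2]
    simp
  rw [hid, norm_smul, norm_sub_rev]
  have h3 := Matrix.l2_opNorm_mul (transfer A (1 : Matrix (Fin n) (Fin n) ℂ) z *
        transfer A (1 : Matrix (Fin n) (Fin n) ℂ) w) B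
  have h4 := Matrix.l2_opNorm_mul (transfer A (1 : Matrix (Fin n) (Fin n) ℂ) z)
        (transfer A (1 : Matrix (Fin n) (Fin n) ℂ) w)
  have h5 := mul_le_mul (hM' z) (hM' w) (norm_nonneg _) (abs_nonneg M)
  have h6 := mul_le_mul_of_nonneg_right (h4.trans h5) (norm_nonneg B)
  rw [mul_comm]
  exact mul_le_mul_of_nonneg_right (h3.trans h6) (norm_nonneg _)

/-- `G* Λ G` is Lipschitz on the circle, with a constant proportional to the norm of `Λ`. -/
theorem exists_norm_sandwichMap_sub_le (A : Matrix (Fin n) (Fin n) ℂ) (B : Matrix (Fin n) (Fin m) ℂ)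
    (hA : IsStable A) :
    ∃ K : ℝ, 0 ≤ K ∧ ∀ (Λ : RangeGamma A B hA) (z w : Circle),
      ‖sandwichMap A B hA Λ z - sandwichMap A B hA Λ w‖ ≤ K * ‖Λ‖ * ‖(z : ℂ) - (w : ℂ)‖ := by
  obtain ⟨K, hK0, hK⟩ := exists_norm_transfer_sub_le hA B
  obtain ⟨M, hM⟩ := isCompact_univ.exists_bound_of_continuousOn (continuous_transfer hA B).continuousOn
  have hM' : ∀ z, ‖transfer A B z‖ ≤ |M| := fun z => (hM z trivial).trans (le_abs_self M)
  let ι := LinearMap.toContinuousLinearMap (RangeGamma.toMatrixLinear (A := A) (B := B) (hA := hA))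
  have hι : ∀ Λ : RangeGamma A B hA, ‖Λ.toMatrix‖ ≤ ‖ι‖ * ‖Λ‖ := fun Λ => ι.le_opNorm Λ
  refine ⟨2 * (|M| * ‖ι‖ * K), by positivity, fun Λ z w => ?_⟩
  rw [sandwichMap_apply, sandwichMap_apply]
  set X := Λ.toMatrix
  set a := transfer A B z
  set b := transfer A B w
  have hsplit : aᴴ * X * a - bᴴ * X * b = aᴴ * (X * (a - b)) + (a - b)ᴴ * (X * b) := by
    rw [Matrix.conjTranspose_sub, Matrix.mul_sub, Matrix.mul_sub, Matrix.sub_mul]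
    simp only [Matrix.mul_assoc]
    abel
  have hX : ‖X‖ ≤ ‖ι‖ * ‖Λ‖ := hι Λ
  have hd : ‖a - b‖ ≤ K * ‖(z : ℂ) - (w : ℂ)‖ := hK z w
  have hιΛ : 0 ≤ ‖ι‖ * ‖Λ‖ := by positivity
  have hd0 : 0 ≤ K * ‖(z : ℂ) - (w : ℂ)‖ := by positivity
  have e1 : ‖aᴴ * (X * (a - b))‖ ≤ |M| * (‖ι‖ * ‖Λ‖ * (K * ‖(z : ℂ) - (w : ℂ)‖)) := by
    refine (Matrix.l2_opNorm_mul _ _).trans ?_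
    rw [Matrix.l2_opNorm_conjTranspose]
    refine mul_le_mul (hM' z) ?_ (norm_nonneg _) (abs_nonneg _)
    exact (Matrix.l2_opNorm_mul _ _).trans (mul_le_mul hX hd (norm_nonneg _) hιΛ)
  have e2 : ‖(a - b)ᴴ * (X * b)‖ ≤ K * ‖(z : ℂ) - (w : ℂ)‖ * (‖ι‖ * ‖Λ‖ * |M|) := by
    refine (Matrix.l2_opNorm_mul _ _).trans ?_
    rw [Matrix.l2_opNorm_conjTranspose]
    refine mul_le_mul hd ?_ (norm_nonneg _) hd0
    exact (Matrix.l2_opNorm_mul _ _).trans (mul_le_mul hX (hM' w) (norm_nonneg _) hιΛ)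
  rw [hsplit]
  refine (norm_add_le _ _).trans ((add_le_add e1 e2).trans_eq ?_)
  ring

theorem norm_circle_exp_sub_le (s t : ℝ) :
    ‖(Circle.exp s : ℂ) - (Circle.exp t : ℂ)‖ ≤ |s - t| := by
  have h : (Circle.exp s : ℂ) - (Circle.exp t : ℂ) =
      Circle.exp t * (Complex.exp (Complex.I * ((s - t : ℝ) : ℂ)) - 1) := by
    have h1 : Complex.exp (Complex.I * ((s - t : ℝ) : ℂ)) = (Circle.exp (s - t) : ℂ) := by
      rw [Circle.coe_exp, mul_comm]
    rw [h1, mul_sub, mul_one, ← Circle.coe_mul, ← Circle.exp_add, add_sub_cancel]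
  rw [h, norm_mul, Circle.norm_coe, one_mul]
  exact Real.norm_exp_I_mul_ofReal_sub_one_le

/-- Its divergence as `q → 0` is what keeps `Q` away from singular matrices. -/
theorem integral_inv_add_mul {q L t r : ℝ} (hq : 0 < q) (hL : 0 < L) (hr : 0 ≤ r) :
    ∫ θ in t..(t + r), (q + L * (θ - t))⁻¹ = L⁻¹ * Real.log ((q + L * r) / q) := by
  have hpos : ∀ θ ∈ Set.uIcc t (t + r), 0 < q + L * (θ - t) := by
    intro θ hθ
    rw [Set.uIcc_of_le (by linarith)] at hθ
    have := mul_nonneg hL.le (sub_nonneg.2 hθ.1)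
    linarith
  have hderiv : ∀ θ ∈ Set.uIcc t (t + r),
      HasDerivAt (fun θ => L⁻¹ * Real.log (q + L * (θ - t))) (q + L * (θ - t))⁻¹ θ := by
    intro θ hθ
    have h1 : HasDerivAt (fun θ => q + L * (θ - t)) L θ := by
      simpa using (((hasDerivAt_id θ).sub_const t).const_mul L).const_add q
    have h2 := (h1.log (hpos θ hθ).ne').const_mul L⁻¹
    rwa [← mul_div_assoc, inv_mul_cancel₀ hL.ne', one_div] at h2
  have hint : IntervalIntegrable (fun θ => (q + L * (θ - t))⁻¹) MeasureTheory.volume t (t + r) := by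
    refine ContinuousOn.intervalIntegrable (ContinuousOn.inv₀ (by fun_prop) fun θ hθ =>
      (hpos θ hθ).ne')
  rw [intervalIntegral.integral_eq_sub_of_hasDerivAt hderiv hint, ← mul_sub,
    Real.log_div (by have := mul_nonneg hL.le hr; linarith) hq.ne']
  simp

/-- A positive definite function on the circle whose quadratic forms are Lipschitz is bounded below
in terms of the mean of the trace of its inverse. -/
theorem le_quadForm_of_circleMean_le {F : Circle → Matrix (Fin m) (Fin m) ℂ}
    (hF : ∀ z, (F z).PosDef) (hFi : Continuous fun z => (F z)⁻¹) {L M : ℝ} (hL : 0 < L)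
    (hlip : ∀ z w, ‖F z - F w‖ ≤ L * ‖(z : ℂ) - (w : ℂ)‖)
    (hM : circleMean (fun z => ((F z)⁻¹).trace.re) ≤ M) (z : Circle) {v : Fin m → ℂ}
    (hv : v ∈ unitVectors m) :
    L * (2 * Real.pi) * Real.exp (-(L * (2 * Real.pi * M))) ≤ quadForm (F z) v := by
  set t := Complex.arg z with ht
  have hzt : Circle.exp t = z := Circle.exp_arg z
  set q := quadForm (F z) v with hq
  have hq0 : 0 < q := quadForm_pos (hF z) hv
  have h2pi : 0 < 2 * Real.pi := Real.two_pi_pos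
  -- Along the arc starting at `z`, the form at the fixed vector `v` grows at most linearly from
  -- `q`, and its reciprocal is a lower bound for the trace of the inverse.
  have hpt : ∀ θ ∈ Set.Icc t (t + 2 * Real.pi),
      (q + L * (θ - t))⁻¹ ≤ ((F (Circle.exp θ))⁻¹).trace.re := by
    intro θ hθ
    refine le_trans ?_ (inv_quadForm_le_re_trace_inv (hF _) hv)
    refine inv_anti₀ (quadForm_pos (hF _) hv) ?_
    have h1 := abs_quadForm_le (F (Circle.exp θ) - F z) hv
    rw [quadForm_sub] at h1
    have h2 := hlip (Circle.exp θ) z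
    have h3 : ‖(Circle.exp θ : ℂ) - (z : ℂ)‖ ≤ θ - t := by
      have := norm_circle_exp_sub_le θ t
      rwa [hzt, abs_of_nonneg (sub_nonneg.2 hθ.1)] at this
    have h4 := mul_le_mul_of_nonneg_left h3 hL.le
    have h5 := (le_abs_self _).trans (h1.trans (h2.trans h4))
    linarith
  have hcont : ContinuousOn (fun θ => (q + L * (θ - t))⁻¹) (Set.uIcc t (t + 2 * Real.pi)) := by
    refine ContinuousOn.inv₀ (by fun_prop) fun θ hθ => ?_
    rw [Set.uIcc_of_le (by linarith)] at hθ
    have := mul_nonneg hL.le (sub_nonneg.2 hθ.1)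
    linarith
  have hint := intervalIntegral.integral_mono_on (by linarith : t ≤ t + 2 * Real.pi)
    (hcont.intervalIntegrable (μ := MeasureTheory.volume))
    (((continuous_re_trace hFi).comp Circle.exp.continuous).intervalIntegrable _ _) hpt
  rw [integral_inv_add_mul hq0 hL h2pi.le] at hint
  rw [circleMean_eq_shift _ t, inv_mul_le_iff₀ h2pi] at hM
  have h6 := hint.trans hM
  rw [inv_mul_le_iff₀ hL] at h6
  have hLp : 0 < L * (2 * Real.pi) := by positivity
  -- Exponentiating gives `q + 2πL ≤ q exp(2πLM)`; dropping the `q` on the left yields the bound.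
  rw [Real.log_le_iff_le_exp (by positivity), div_le_iff₀ hq0] at h6
  rw [Real.exp_neg, ← div_eq_mul_inv, div_le_iff₀ (Real.exp_pos _)]
  linarith

theorem isCompact_sublevel (hfeas : IsFeasible A B) {Ψ : Circle → Matrix (Fin m) (Fin m) ℂ}
    (hΨ : IsSpectralDensity Ψ) : IsCompact (sublevel A B hA Ψ) := by
  obtain ⟨c, C, hc, hJ⟩ := exists_le_J (hA := hA) hfeas hΨ
  set r := (normCircleIntegral Ψ).trace.re with hr
  have hmean0 : ∀ f : Circle → ℝ, Continuous f → (∀ z, 0 ≤ f z) → 0 ≤ circleMean f := by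
    intro f hf h0
    have := circleMean_mono (circleInt_of_continuous continuous_const)
      (circleInt_of_continuous hf) h0
    rwa [circleMean_const] at this
  set M := (r + C) / c with hM
  have hbounds : ∀ Λ ∈ sublevel A B hA Ψ,
      circleMean (fun z => ((Q A B Λ.toMatrix z)⁻¹).trace.re) ≤ M ∧
      circleMean (fun z => (Q A B Λ.toMatrix z).trace.re) ≤ M := by
    intro Λ hΛ
    have hpos := (mem_LHGamma_iff Λ).1 hΛ.1
    have h1 := hJ Λ hΛ.1
    have h2 : J A B hA Ψ Λ ≤ r := hΛ.2
    have h3 := hmean0 _ (continuous_re_trace (continuous_Q_inv hΛ.1))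
      fun z => (Complex.le_def.1 (hpos z).inv.posSemidef.trace_nonneg).1
    have h4 := hmean0 _ (continuous_re_trace (continuous_Q Λ))
      fun z => (Complex.le_def.1 (hpos z).posSemidef.trace_nonneg).1
    have h5 := mul_nonneg hc.le h3
    have h6 := mul_nonneg hc.le h4
    constructor <;> rw [hM, le_div_iff₀ hc] <;> linarith
  obtain ⟨c', hc', hnorm⟩ := exists_pos_mul_norm_le_circleMean (sandwichMap A B hA)
    sandwichMap_injective
  set R := (M + ‖(1 : Matrix (Fin m) (Fin m) ℂ)‖) / c' with hR
  have hRb : ∀ Λ ∈ sublevel A B hA Ψ, ‖Λ‖ ≤ R := by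
    intro Λ hΛ
    have hpos := (mem_LHGamma_iff Λ).1 hΛ.1
    rw [hR, le_div_iff₀ hc', mul_comm]
    refine (hnorm Λ).trans ?_
    have hci := circleInt_of_continuous (continuous_re_trace (continuous_Q Λ))
    have h1 : circleMean (fun z => ‖sandwichMap A B hA Λ z‖) ≤ circleMean fun z =>
        (Q A B Λ.toMatrix z).trace.re + ‖(1 : Matrix (Fin m) (Fin m) ℂ)‖ := by
      refine circleMean_mono (circleInt_of_continuous (sandwichMap A B hA Λ).continuous.norm)
        (circleInt_of_continuous ((continuous_re_trace (continuous_Q Λ)).add continuous_const))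
        fun z => ?_
      have h2 : sandwichMap A B hA Λ z = Q A B Λ.toMatrix z - 1 := by
        rw [← one_add_sandwichMap_apply]
        simp
      rw [h2]
      exact (norm_sub_le _ _).trans (add_le_add_left (norm_le_re_trace (hpos z).posSemidef) _)
    rw [circleMean_add hci (circleInt_of_continuous continuous_const), circleMean_const] at h1
    linarith [(hbounds Λ hΛ).2]
  obtain ⟨K, hK0, hK⟩ := exists_norm_sandwichMap_sub_le A B hA
  -- A Lipschitz constant for every `Q` from the sublevel set at once; the `1` keeps it positive.
  set L := K * |R| + 1 with hL
  have hL0 : 0 < L := by positivity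
  set ε := L * (2 * Real.pi) * Real.exp (-(L * (2 * Real.pi * M))) with hε
  have hε0 : 0 < ε := by positivity
  have hlow : ∀ Λ ∈ sublevel A B hA Ψ, ∀ z, ∀ v ∈ unitVectors m,
      ε ≤ quadForm (Q A B Λ.toMatrix z) v := by
    intro Λ hΛ z v hv
    refine le_quadForm_of_circleMean_le ((mem_LHGamma_iff Λ).1 hΛ.1) (continuous_Q_inv hΛ.1) hL0
      (fun z w => ?_) (hbounds Λ hΛ).1 z hv
    have h1 : Q A B Λ.toMatrix z - Q A B Λ.toMatrix w =
        sandwichMap A B hA Λ z - sandwichMap A B hA Λ w := by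
      simp [Q, sandwichMap_apply]
    rw [h1]
    refine (hK Λ z w).trans (mul_le_mul_of_nonneg_right ?_ (norm_nonneg _))
    have := mul_le_mul_of_nonneg_left ((hRb Λ hΛ).trans (le_abs_self R)) hK0
    linarith
  -- A compact subset of `LHGamma` containing the sublevel set. `J` is continuous on it, so the
  -- sublevel condition cuts out a closed subset.
  let 𝒦 : Set (RangeGamma A B hA) := Metric.closedBall 0 R ∩
    {Λ | ∀ z, ∀ v ∈ unitVectors m, ε ≤ quadForm (Q A B Λ.toMatrix z) v}
  have hcl : IsClosed {Λ : RangeGamma A B hA |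
      ∀ z, ∀ v ∈ unitVectors m, ε ≤ quadForm (Q A B Λ.toMatrix z) v} := by
    simp only [Set.ofPred_forall]
    refine isClosed_iInter fun z => isClosed_iInter fun v => isClosed_iInter fun _ => ?_
    refine isClosed_le continuous_const (continuous_quadForm.comp (Continuous.prodMk ?_
      continuous_const))
    exact continuous_const.add
      ((continuous_const.matrix_mul continuous_toMatrix).matrix_mul continuous_const)
  have hproper := FiniteDimensional.proper ℝ (RangeGamma A B hA)
  have h𝒦 : IsCompact 𝒦 := (isCompact_closedBall 0 R).inter_right hcl
  have h𝒦U : 𝒦 ⊆ LHGamma A B hA := fun Λ hΛ => (mem_LHGamma_iff Λ).2 fun z =>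
    posDef_of_quadForm_pos (isHermitian_Q Λ z) fun v hv => hε0.trans_le (hΛ.2 z v hv)
  have hSeq : sublevel A B hA Ψ = 𝒦 ∩ J A B hA Ψ ⁻¹' Set.Iic r := by
    ext Λ
    constructor
    · intro hΛ
      exact ⟨⟨by simpa using hRb Λ hΛ, hlow Λ hΛ⟩, hΛ.2⟩
    · rintro ⟨h1, h2⟩
      exact ⟨h𝒦U h1, h2⟩
  rw [hSeq]
  refine h𝒦.of_isClosed_subset ?_ Set.inter_subset_left
  refine ContinuousOn.preimage_isClosed_of_isClosed (fun Λ hΛ => ?_) h𝒦.isClosed isClosed_Iic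
  exact (contDiffAt_J hΨ (h𝒦U hΛ)).continuousAt.continuousWithinAt

end Compactness

end HellingerNewton

theorem mainTheorem2 {n m : ℕ} (A : Matrix (Fin n) (Fin n) ℂ) (B : Matrix (Fin n) (Fin m) ℂ)
    (hA : IsStable A) (hB : B.rank = min n m) (hAB : IsReachable A B)
    (hfeas : IsFeasible A B)
    (Ψ : Circle → Matrix (Fin m) (Fin m) ℂ) (hΨ : IsSpectralDensity Ψ) :
    IsCompact (sublevel A B hA Ψ) ∧
    (∀ Λ ∈ sublevel A B hA Ψ, ContDiffAt ℝ 2 (J A B hA Ψ) Λ) ∧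
    (∃ c : ℝ, 0 < c ∧ ∀ Λ ∈ sublevel A B hA Ψ, ∀ δ : RangeGamma A B hA,
      c * ‖δ‖ ^ 2 ≤ hess A B hA Ψ Λ δ δ) ∧
    (∃ K : NNReal, LipschitzOnWith K (hess A B hA Ψ) (sublevel A B hA Ψ)) ∧
    (∃ Λmin ∈ LHGamma A B hA,
      (∀ Λ ∈ LHGamma A B hA, J A B hA Ψ Λmin ≤ J A B hA Ψ Λ) ∧
      (∀ Λ' ∈ LHGamma A B hA,
        (∀ Λ ∈ LHGamma A B hA, J A B hA Ψ Λ' ≤ J A B hA Ψ Λ) → Λ' = Λmin) ∧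
      (∀ α : ℝ, 0 < α → α < 1 / 2 →
        (∃! Λ : ℕ → RangeGamma A B hA, IsNewtonSequence A B hA Ψ α Λ) ∧
        (∀ Λ : ℕ → RangeGamma A B hA, IsNewtonSequence A B hA Ψ α Λ →
          Filter.Tendsto Λ Filter.atTop (𝓝 Λmin)))) := by
  have hS := isCompact_sublevel (hA := hA) hfeas hΨ
  have hf : ∀ Λ ∈ LHGamma A B hA, ContDiffAt ℝ 3 (J A B hA Ψ) Λ := fun Λ hΛ => contDiffAt_J hΨ hΛ
  have hpos : ∀ Λ ∈ LHGamma A B hA, ∀ δ : RangeGamma A B hA, δ ≠ 0 →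
      0 < fderiv ℝ (fderiv ℝ (J A B hA Ψ)) Λ δ δ := fun Λ hΛ δ hδ => hess_J_pos hΨ hΛ hδ
  have hSJ : sublevel A B hA Ψ = {Λ | Λ ∈ LHGamma A B hA ∧ J A B hA Ψ Λ ≤ J A B hA Ψ 0} := by
    rw [J_zero]
    rfl
  refine ⟨hS, fun Λ hΛ => (hf Λ hΛ.1).of_le (by norm_num),
    exists_pos_le_hessian hS (fun Λ hΛ => hf Λ hΛ.1) fun Λ hΛ => hpos Λ hΛ.1,
    -- Convexity of the sublevel set lets a bound on the third derivative control the Hessian along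
    -- segments.
    exists_lipschitzOnWith_hessian hS (convex_sublevel_of_hessian_pos convex_LHGamma hf hpos _)
      fun Λ hΛ => hf Λ hΛ.1, ?_⟩
  rw [hSJ] at hS
  obtain ⟨Λmin, hmem, hmin, huniq, hnewton⟩ := exists_minimum_and_newton_tendsto isOpen_LHGamma
    convex_LHGamma hf hpos zero_mem_LHGamma hS
  exact ⟨Λmin, hmem, hmin, huniq, fun α h0 h1 => hnewton α h0 (by linarith)⟩
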